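/- A planted plane tree is a finite rooted tree, with at least one vertex, in which every vertex may have arbitrarily many children and the children of each vertex are linearly ordered from left to right; two such trees are identified if they are isomorphic as ordered rooted trees. Let $\mathcal T_n$ denote the (finite) set of planted plane trees with exactly $n$ vertices. View a planted plane tree $T$ as a poset in which $v\le w$ if and only if $v=w$ or $v$ is a descendant of $w$, so that the root is the maximal element. For planted plane trees $S$ and $T$, an embedding of $S$ into $T$ is a set $X$ of vertices of $T$ such that the subposet of $T$ induced on $X$ is isomorphic to $S$ by an isomorphism under which the left-to-right order of the children of each vertex of $S$ is the one inherited from $T$. An embedding is good if it contains the root of $T$. Write $S\subseteq T$ if there is at least one embedding of $S$ into $T$. Let $a_{T}(S)$ and $g_{T}(S)$ be the numbers of all embeddings and of good embeddings of $S$ into $T$, and put $$a_{\mathcal T_n}(S)=\sum_{T\in\mathcal T_n}a_T(S),\qquad g_{\mathcal T_n}(S)=\sum_{T\in\mathcal T_n}g_T(S).$$ Let $S_1,S_2$ be planted plane trees with $S_1\subseteq S_2$. Then for all sufficiently large $n$ the numbers $a_{\mathcal T_n}(S_1)$ and $a_{\mathcal T_n}(S_2)$ are positive and $$\frac{g_{\mathcal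 T_n}(S_1)}{a_{\mathcal T_n}(S_1)}\le\frac{g_{\mathcal T_n}(S_2)}{a_{\mathcal T_n}(S_2)}.$$ -/

import Mathlib

/-- Plane rooted trees (Catalan trees): a root together with the finite ordered list, read from left
to right, of the plane rooted trees attached to it. There is no empty tree. -/
inductive PlaneTree : Type where
  | node : List PlaneTree → PlaneTree

namespace PlaneTree

/-- `IsVertex p T` says that the address `p` leads to a vertex of `T`: the root has the address `[]`,
and if the `i`-th subtree attached to the root (counted from the left, starting at `0`) has a vertex
with address `q`, then this vertex has the address `i :: q` in the whole tree. -/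
def IsVertex : List ℕ → PlaneTree → Prop
  | [], _ => True
  | i :: p, node ts => ∃ t, ts[i]? = some t ∧ IsVertex p t

/-- The vertex set of a plane tree, each vertex being given by its address. -/
def vertices (T : PlaneTree) : Set (List ℕ) := {p | IsVertex p T}

/-- The size of a plane tree: its number of vertices. -/
noncomputable def size (T : PlaneTree) : ℕ := T.vertices.ncard

/-- The tree order on the addresses: `Below v w` says that `v` is `w` or a descendant of `w`.
The root is the maximal element. -/
def Below (v w : List ℕ) : Prop := w <+: v

/-- The left-to-right order on the addresses: `LeftOf v w` says that there is a vertex `p` such that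
`v` and `w` lie in the subtrees of two different children of `p`, the one for `v` being further to
the left. -/
def LeftOf (v w : List ℕ) : Prop :=
  ∃ (p : List ℕ) (i j : ℕ), i < j ∧ Below v (p ++ [i]) ∧ Below w (p ++ [j])

/-- A set `X` of vertices of `T` is a (plane) embedding of `S` into `T` if the subposet of `T`
induced on `X` is isomorphic to the poset `S` by an isomorphism under which the left-to-right order
of the children of each vertex of `S` is the one inherited from `T`. -/
def IsEmbedding (S T : PlaneTree) (X : Set (List ℕ)) : Prop :=
  X ⊆ T.vertices ∧
    ∃ f : S.vertices ≃ X,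
      (∀ u v : S.vertices, Below (u : List ℕ) v ↔ Below (f u : List ℕ) (f v)) ∧
      (∀ (p : List ℕ) (i j : ℕ) (hi : p ++ [i] ∈ S.vertices) (hj : p ++ [j] ∈ S.vertices),
        i < j → LeftOf (f ⟨p ++ [i], hi⟩ : List ℕ) (f ⟨p ++ [j], hj⟩))

/-- `S ⊆ T`: there is at least one embedding of `S` into `T`. -/
def EmbedsInto (S T : PlaneTree) : Prop := ∃ X, IsEmbedding S T X

/-- The number `a_T(S)` of all embeddings of `S` into `T`. -/
noncomputable def allCount (T S : PlaneTree) : ℕ := {X | IsEmbedding S T X}.ncard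

/-- The number `g_T(S)` of good embeddings of `S` into `T`: those that contain the root of `T`. -/
noncomputable def goodCount (T S : PlaneTree) : ℕ := {X | IsEmbedding S T X ∧ [] ∈ X}.ncard

theorem cons_mem_vertices {ts : List PlaneTree} {i : ℕ} {p : List ℕ} :
    i :: p ∈ (node ts).vertices ↔ ∃ t, ts[i]? = some t ∧ p ∈ t.vertices := Iff.rfl

theorem nil_mem_vertices (T : PlaneTree) : [] ∈ T.vertices := by
  cases T; trivial

theorem finite_vertices : (T : PlaneTree) → T.vertices.Finite
  | node ts => by
    have ih : ∀ t ∈ ts, t.vertices.Finite := fun t _ => finite_vertices t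
    have hfin : (⋃ i : Fin ts.length, (List.cons i.1) '' (ts[i.1]).vertices).Finite :=
      Set.finite_iUnion fun i => (ih _ (List.getElem_mem i.2)).image _
    refine (hfin.insert []).subset ?_
    rintro (_ | ⟨i, p⟩) hp
    · exact Set.mem_insert _ _
    · obtain ⟨t, ht, hpt⟩ := cons_mem_vertices.1 hp
      obtain ⟨hi, rfl⟩ := List.getElem?_eq_some_iff.1 ht
      exact Set.mem_insert_of_mem _ (Set.mem_iUnion.2 ⟨⟨i, hi⟩, p, hpt, rfl⟩)
termination_by T => sizeOf T
decreasing_by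
  have := List.sizeOf_lt_of_mem ‹_ ∈ ts›
  simp only [node.sizeOf_spec]
  omega

/-- The sets of embeddings that are counted by `allCount` and `goodCount` are finite. -/
theorem finite_embeddings (S T : PlaneTree) : {X | IsEmbedding S T X}.Finite :=
  (finite_vertices T).finite_subsets.subset fun _ hX => hX.1

theorem size_lt_of_mem {ts : List PlaneTree} {t : PlaneTree} (ht : t ∈ ts) :
    t.size < (node ts).size := by
  obtain ⟨i, hi⟩ := List.mem_iff_getElem?.1 ht
  have h1 : (List.cons i '' t.vertices).ncard = t.size :=
    Set.ncard_image_of_injective _ (List.cons_injective)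
  rw [← h1]
  refine Set.ncard_lt_ncard ⟨?_, fun h => ?_⟩ (finite_vertices _)
  · rintro _ ⟨p, hp, rfl⟩
    exact cons_mem_vertices.2 ⟨t, hi, hp⟩
  · obtain ⟨p, -, hp⟩ := h (nil_mem_vertices (node ts))
    exact List.cons_ne_nil _ _ hp

theorem length_lt_size (ts : List PlaneTree) : ts.length < (node ts).size := by
  have h1 : ((fun i : ℕ => [i]) '' (Set.Iio ts.length)).ncard = ts.length := by
    rw [Set.ncard_image_of_injective _ (fun a b h => by simpa using h)]
    simp [Set.ncard_eq_toFinset_card']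
  conv_lhs => rw [← h1]
  refine Set.ncard_lt_ncard ⟨?_, fun h => ?_⟩ (finite_vertices _)
  · rintro _ ⟨i, hi, rfl⟩
    exact cons_mem_vertices.2 ⟨_, List.getElem?_eq_getElem hi, nil_mem_vertices _⟩
  · obtain ⟨p, -, hp⟩ := h (nil_mem_vertices (node ts))
    exact List.cons_ne_nil _ _ hp

theorem finite_size_lt (n : ℕ) : {T : PlaneTree | T.size < n}.Finite := by
  induction n with
  | zero => simp
  | succ n ih =>
    have : Finite {T : PlaneTree | T.size < n} := ih
    have h := (((List.finite_length_lt {T : PlaneTree | T.size < n} n).image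
      (List.map Subtype.val)).image node)
    refine h.subset ?_
    rintro ⟨ts⟩ hT
    have hT' : (node ts).size < n + 1 := hT
    have hmem : ∀ t ∈ ts, t.size < n := fun t ht => by
      have := size_lt_of_mem ht
      omega
    have hlen := length_lt_size ts
    refine ⟨ts, ⟨ts.attach.map fun t => ⟨t.1, hmem t.1 t.2⟩, ?_, ?_⟩, rfl⟩
    · have : (ts.attach.map fun t => (⟨t.1, hmem t.1 t.2⟩ : {T : PlaneTree | T.size < n})).length
          < n := by
        rw [List.length_map, List.length_attach]
        omega
      exact this
    · simp [List.map_map, Function.comp_def]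

theorem finite_size_eq (n : ℕ) : {T : PlaneTree | T.size = n}.Finite :=
  (finite_size_lt (n + 1)).subset fun T (hT : T.size = n) => 
    (Nat.lt_succ_of_le hT.le : T.size < n + 1)

/-- The family `𝒯ₙ` of all planted plane trees of size `n`. -/
noncomputable def plantedTrees (n : ℕ) : Finset PlaneTree := (finite_size_eq n).toFinset

/-- The cumulative number `∑ a_T(S)` over all `T ∈ 𝒯ₙ` of all embeddings of `S`. -/
noncomputable def allTotal (n : ℕ) (S : PlaneTree) : ℕ := ∑ T ∈ plantedTrees n, allCount T S

/-- The cumulative number `∑ g_T(S)` over all `T ∈ 𝒯ₙ` of good embeddings of `S`. -/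
noncomputable def goodTotal (n : ℕ) (S : PlaneTree) : ℕ := ∑ T ∈ plantedTrees n, goodCount T S

end PlaneTree

/-! Write $w=\sqrt{1-4x}$, so that plane trees have generating function $C=(1-w)/2$. A good
embedding of a tree $S$ with $k$ branches at the root amounts to marking $k$ incomparable non-root
vertices of $T$ and choosing, in the subtree at the $i$-th of them, a good embedding of the $i$-th
branch of $S$. Hence the series $R_S$ of good embeddings is a series depending only on $k$ times the
product of the series of the branches (`forestSeries_eq_markedSeries`). By induction
$R_S=w^{-\omega}p(w)$ with $p$ a polynomial, $p(0)>0$ and $\omega$ = `weight S`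
(`leading_rootSeries`). Locating the image of the root of $S$ gives the series of all embeddings,
$\frac{1+w}{2w}R_S$ (`treeSeries_eq_rootSeries`).

The coefficients of powers of $w$ are explicit, and each extra factor $w$ makes them negligible. If
$\omega>0$, the unknown $p(0)$ therefore cancels, and the ratio of good to all embeddings is
asymptotic to $2r_{\omega/2}(n)$, where $r_s(n)$ is the quotient of the $n$-th coefficients of
$w^{-2s}$ and $w^{-2s-1}$ (`tendsto_ratio`). For $s<t$ there is $\delta<1$ with
$r_s(n)\le\delta\,r_t(n)$ for all $n\ge1$ (`powCoeff_div_le`), so a larger weight eventually wins by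
a constant factor. The one-vertex tree has $\omega=0$; there the constant $p(0)$ does not reach the
coefficients, and the ratio is $o(r_{1/2}(n))$.

It remains that the weight grows strictly under proper containment (`EmbedsInto.weight_lt`):
$\omega+2$ is the number of vertices plus the number of leaves. -/

namespace PlaneTree

/-! ### The two orders on addresses -/

theorem below_nil (v : List ℕ) : Below v [] := List.nil_prefix

theorem not_below_nil_cons (i : ℕ) (w : List ℕ) : ¬ Below [] (i :: w) := by
  simp [Below]

theorem below_cons {i j : ℕ} {v w : List ℕ} : Below (i :: v) (j :: w) ↔ i = j ∧ Below v w := by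
  simp [Below, List.cons_prefix_cons, eq_comm]

theorem below_refl (v : List ℕ) : Below v v := List.prefix_rfl

theorem Below.trans {u v w : List ℕ} (h : Below u v) (h' : Below v w) : Below u w :=
  List.IsPrefix.trans h' h

theorem Below.antisymm {u v : List ℕ} (h : Below u v) (h' : Below v u) : u = v :=
  List.IsPrefix.eq_of_length h' (le_antisymm (List.IsPrefix.length_le h') (List.IsPrefix.length_le h))

theorem not_leftOf_nil_left (w : List ℕ) : ¬ LeftOf [] w := by
  rintro ⟨p, i, j, -, h, -⟩
  simp [Below] at h

theorem not_leftOf_nil_right (v : List ℕ) : ¬ LeftOf v [] := by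
  rintro ⟨p, i, j, -, -, h⟩
  simp [Below] at h

theorem leftOf_cons {i j : ℕ} {v w : List ℕ} :
    LeftOf (i :: v) (j :: w) ↔ i < j ∨ i = j ∧ LeftOf v w := by
  constructor
  · rintro ⟨_ | ⟨a, p⟩, k, l, hkl, h1, h2⟩
    · simp only [List.nil_append, below_cons] at h1 h2
      omega
    · simp only [List.cons_append, below_cons] at h1 h2
      exact Or.inr ⟨h1.1.trans h2.1.symm, p, k, l, hkl, h1.2, h2.2⟩
  · rintro (h | ⟨rfl, p, k, l, hkl, h1, h2⟩)
    · exact ⟨[], i, j, h, below_cons.2 ⟨rfl, below_nil _⟩, below_cons.2 ⟨rfl, below_nil _⟩⟩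
    · exact ⟨i :: p, k, l, hkl, below_cons.2 ⟨rfl, h1⟩, below_cons.2 ⟨rfl, h2⟩⟩

theorem LeftOf.mono {u v u' v' : List ℕ} (h : LeftOf u v) (hu : Below u' u) (hv : Below v' v) :
    LeftOf u' v' := by
  obtain ⟨p, i, j, hij, h1, h2⟩ := h
  exact ⟨p, i, j, hij, hu.trans h1, hv.trans h2⟩

theorem LeftOf.not_below : ∀ {u v : List ℕ}, LeftOf u v → ¬ Below u v
  | [], _, h => absurd h (not_leftOf_nil_left _)
  | _, [], h => absurd h (not_leftOf_nil_right _)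
  | i :: u, j :: v, h => by
    rw [below_cons]
    rintro ⟨rfl, h'⟩
    rcases leftOf_cons.1 h with h | h
    · omega
    · exact h.2.not_below h'

theorem LeftOf.not_above : ∀ {u v : List ℕ}, LeftOf u v → ¬ Below v u
  | [], _, h => absurd h (not_leftOf_nil_left _)
  | _, [], h => absurd h (not_leftOf_nil_right _)
  | i :: u, j :: v, h => by
    rw [below_cons]
    rintro ⟨rfl, h'⟩
    rcases leftOf_cons.1 h with h | h
    · omega
    · exact h.2.not_above h'

theorem LeftOf.asymm : ∀ {u v : List ℕ}, LeftOf u v → ¬ LeftOf v u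
  | [], _, h => absurd h (not_leftOf_nil_left _)
  | _, [], h => absurd h (not_leftOf_nil_right _)
  | i :: u, j :: v, h => by
    rw [leftOf_cons]
    rcases leftOf_cons.1 h with h | ⟨hij, h⟩
    · omega
    · rintro (h' | ⟨-, h'⟩)
      · omega
      · exact LeftOf.asymm h h'

/-! ### Copies of a plane forest as sets of addresses -/

/-- `Realizes L X` says that the set `X` of addresses, with the induced tree order and left-to-right
order, is a copy of the plane forest `L`. -/
inductive Realizes : List PlaneTree → Set (List ℕ) → Prop
  | nil : Realizes [] ∅
  | cons (r : List ℕ) (ss L : List PlaneTree) (X Y : Set (List ℕ)) (hX : Realizes ss X)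
      (hY : Realizes L Y) (hr : ∀ x ∈ X, Below x r ∧ x ≠ r) (hl : ∀ y ∈ Y, LeftOf r y) :
      Realizes (node ss :: L) (insert r (X ∪ Y))

theorem Realizes.eq_nil {L : List PlaneTree} (h : Realizes L ∅) : L = [] := by
  generalize hZ : (∅ : Set (List ℕ)) = Z at h
  cases h with
  | nil => rfl
  | cons r ss L X Y => exact absurd (hZ ▸ Set.mem_insert r _) (Set.notMem_empty r)

/-- The root of the first tree is the only element from which every other one is a descendant or
lies to the right; its descendants then separate the first tree from the rest. This makes the sum in
`forestCount_cons` disjoint. -/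
theorem Realizes.unique {L L' : List PlaneTree} {X : Set (List ℕ)} (h : Realizes L X)
    (h' : Realizes L' X) : L = L' := by
  induction h generalizing L' with
  | nil => exact h'.eq_nil.symm
  | cons r ss L X Y hX hY hr hl ihX ihY =>
    generalize hZ : insert r (X ∪ Y) = Z at h'
    cases h' with
    | nil => exact absurd (hZ ▸ Set.mem_insert r _) (Set.notMem_empty r)
    | cons r' ss' L' X' Y' hX' hY' hr' hl' =>
      have mem : ∀ x, x ∈ insert r (X ∪ Y) ↔ x ∈ insert r' (X' ∪ Y') := fun x => by rw [hZ]
      have key : r = r' := by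
        rcases (mem r).1 (Set.mem_insert _ _) with h | h | h
        · exact h
        · rcases (mem r').2 (Set.mem_insert _ _) with k | k | k
          · exact k.symm
          · exact ((hr' _ h).1.antisymm (hr _ k).1)
          · exact absurd (hr' _ h).1 (hl _ k).not_below
        · rcases (mem r').2 (Set.mem_insert _ _) with k | k | k
          · exact k.symm
          · exact absurd (hr _ k).1 (hl' _ h).not_below
          · exact absurd (hl _ k) (hl' _ h).asymm
      subst key
      have eX : X = X' := by
        ext x
        constructor
        · intro hx
          rcases (mem x).1 (Or.inr (Or.inl hx)) with h | h | h
          · exact absurd h (hr x hx).2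
          · exact h
          · exact absurd (hr x hx).1 (hl' _ h).not_above
        · intro hx
          rcases (mem x).2 (Or.inr (Or.inl hx)) with h | h | h
          · exact absurd h (hr' x hx).2
          · exact h
          · exact absurd (hr' x hx).1 (hl _ h).not_above
      have eY : Y = Y' := by
        ext x
        constructor
        · intro hx
          rcases (mem x).1 (Or.inr (Or.inr hx)) with h | h | h
          · exact absurd (h ▸ below_refl r) (h ▸ (hl x hx).not_above)
          · exact absurd (hr' x h).1 (hl _ hx).not_above
          · exact h
        · intro hx
          rcases (mem x).2 (Or.inr (Or.inr hx)) with h | h | h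
          · exact absurd (h ▸ below_refl r) (h ▸ (hl' x hx).not_above)
          · exact absurd (hr x h).1 (hl' _ hx).not_above
          · exact h
      subst eX eY
      rw [ihX hX', ihY hY']

theorem Realizes.append {L M : List PlaneTree} {X Y : Set (List ℕ)} (hX : Realizes L X)
    (hY : Realizes M Y) (h : ∀ x ∈ X, ∀ y ∈ Y, LeftOf x y) : Realizes (L ++ M) (X ∪ Y) := by
  induction hX with
  | nil => simpa using hY
  | cons r ss L X₁ X₂ h₁ h₂ hr hl ih₁ ih₂ =>
    have := Realizes.cons r ss (L ++ M) X₁ (X₂ ∪ Y) h₁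
      (ih₂ fun x hx y hy => h x (Or.inr (Or.inr hx)) y hy) hr (by
        rintro y (hy | hy)
        · exact hl y hy
        · exact h r (Set.mem_insert _ _) y hy)
    rwa [← Set.union_assoc, ← Set.insert_union] at this

/-- A tree whose root lies in `A` stays in `A`, since no element of `B` is below it. Once a root
lies in `B`, its whole tree and everything to its right do too, so the cut falls between two trees
of the list. -/
theorem Realizes.split {L : List PlaneTree} {X A B : Set (List ℕ)} (h : Realizes L X)
    (hX : X ⊆ A ∪ B) (hAB : ∀ a ∈ A, ∀ b ∈ B, LeftOf a b) :
    ∃ M N, L = M ++ N ∧ Realizes M (X ∩ A) ∧ Realizes N (X ∩ B) := by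
  induction h with
  | nil => exact ⟨[], [], rfl, by simpa using Realizes.nil, by simpa using Realizes.nil⟩
  | cons r ss L X Y h₁ h₂ hr hl ih₁ ih₂ =>
    by_cases hrA : r ∈ A
    · obtain ⟨M, N, rfl, hM, hN⟩ := ih₂ fun y hy => hX (Or.inr (Or.inr hy))
      have hXA : X ⊆ A := fun x hx => (hX (Or.inr (Or.inl hx))).resolve_right fun hB =>
        (hAB r hrA x hB).not_above (hr x hx).1
      have hXB : X ∩ B = ∅ := by
        ext x
        simp only [Set.mem_inter_iff, Set.mem_empty_iff_false, iff_false, not_and]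
        exact fun hx hB => (hAB r hrA x hB).not_above (hr x hx).1
      have hrB : r ∉ B := fun hB => (hAB r hrA r hB).not_above (below_refl r)
      refine ⟨node ss :: M, N, rfl, ?_, ?_⟩
      · rw [Set.insert_inter_of_mem hrA, Set.union_inter_distrib_right,
          Set.inter_eq_left.2 hXA]
        exact Realizes.cons r ss M X _ h₁ hM hr fun y hy => hl y hy.1
      · rwa [Set.insert_inter_of_notMem hrB, Set.union_inter_distrib_right, hXB, Set.empty_union]
    · have hrB : r ∈ B := (hX (Set.mem_insert _ _)).resolve_left hrA
      have hA : ∀ x ∈ insert r (X ∪ Y), x ∉ A := by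
        rintro x (rfl | hx | hx) hxA
        · exact hrA hxA
        · exact (hAB x hxA r hrB).not_below (hr x hx).1
        · exact (hAB x hxA r hrB).asymm (hl x hx)
      refine ⟨[], node ss :: L, rfl, ?_, ?_⟩
      · have : insert r (X ∪ Y) ∩ A = ∅ := by
          ext x
          simp only [Set.mem_inter_iff, Set.mem_empty_iff_false, iff_false, not_and]
          exact hA x
        rw [this]
        exact Realizes.nil
      · rw [Set.inter_eq_left.2 fun x hx => (hX hx).resolve_left (hA x hx)]
        exact Realizes.cons r ss L X Y h₁ h₂ hr hl

theorem Realizes.image {φ : List ℕ → List ℕ} (hφ : ∀ u v, Below (φ u) (φ v) ↔ Below u v)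
    (hφ' : ∀ u v, LeftOf (φ u) (φ v) ↔ LeftOf u v) {L : List PlaneTree} {X : Set (List ℕ)}
    (h : Realizes L X) : Realizes L (φ '' X) := by
  induction h with
  | nil => simpa using Realizes.nil
  | cons r ss L X Y h₁ h₂ hr hl ih₁ ih₂ =>
    rw [Set.image_insert_eq, Set.image_union]
    refine Realizes.cons _ _ _ _ _ ih₁ ih₂ ?_ ?_
    · rintro _ ⟨x, hx, rfl⟩
      refine ⟨(hφ _ _).2 (hr x hx).1, fun h => (hr x hx).2 ?_⟩
      exact (hr x hx).1.antisymm ((hφ _ _).1 (h ▸ below_refl _))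
    · rintro _ ⟨x, hx, rfl⟩
      exact (hφ' _ _).2 (hl x hx)

theorem Realizes.preimage {φ : List ℕ → List ℕ} (hφ : ∀ u v, Below (φ u) (φ v) ↔ Below u v)
    (hφ' : ∀ u v, LeftOf (φ u) (φ v) ↔ LeftOf u v) {L : List PlaneTree} {X : Set (List ℕ)}
    (h : Realizes L X) (hX : X ⊆ Set.range φ) : Realizes L (φ ⁻¹' X) := by
  induction h with
  | nil => simpa using Realizes.nil
  | cons r ss L X Y h₁ h₂ hr hl ih₁ ih₂ =>
    obtain ⟨r, rfl⟩ := hX (Set.mem_insert _ _)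
    have : φ ⁻¹' (insert (φ r) (X ∪ Y)) = insert r (φ ⁻¹' X ∪ φ ⁻¹' Y) := by
      ext u
      have : φ u = φ r ↔ u = r := ⟨fun h => ((hφ _ _).1 (h ▸ below_refl _)).antisymm
        ((hφ _ _).1 (h ▸ below_refl _)), fun h => h ▸ rfl⟩
      simp [this]
    rw [this]
    refine Realizes.cons _ _ _ _ _ (ih₁ fun x hx => hX (Or.inr (Or.inl hx)))
      (ih₂ fun x hx => hX (Or.inr (Or.inr hx))) (fun x hx => ?_) fun y hy => (hφ' _ _).1 (hl _ hy)
    exact ⟨(hφ _ _).1 (hr _ hx).1, fun h => (hr _ hx).2 (h ▸ rfl)⟩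

/-! ### Embeddings as copies of a one-tree forest -/

/-- The vertices of a plane forest: those of the tree with this list of branches, without the
root. -/
def forestVertices (L : List PlaneTree) : Set (List ℕ) := (node L).vertices \ {[]}

/-- The injection of addresses that makes room for a new leftmost branch at the root. -/
def shift : List ℕ → List ℕ
  | [] => []
  | i :: p => (i + 1) :: p

theorem below_shift (u v : List ℕ) : Below (shift u) (shift v) ↔ Below u v := by
  cases u <;> cases v <;> simp [shift, below_cons, below_nil, not_below_nil_cons]

theorem leftOf_shift (u v : List ℕ) : LeftOf (shift u) (shift v) ↔ LeftOf u v := by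
  cases u <;> cases v <;>
    simp [shift, leftOf_cons, not_leftOf_nil_left, not_leftOf_nil_right]

theorem shift_injective : Function.Injective shift := fun _ _ h =>
  ((below_shift _ _).1 (h ▸ below_refl _)).antisymm ((below_shift _ _).1 (h ▸ below_refl _))

theorem below_cons_left (i : ℕ) (u v : List ℕ) : Below (i :: u) (i :: v) ↔ Below u v := by
  simp [below_cons]

theorem leftOf_cons_left (i : ℕ) (u v : List ℕ) : LeftOf (i :: u) (i :: v) ↔ LeftOf u v := by
  simp [leftOf_cons]

theorem leftOf_zero_cons_shift {L : List PlaneTree} {v : List ℕ} (u : List ℕ)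
    (hv : v ∈ forestVertices L) : LeftOf (0 :: u) (shift v) := by
  cases v with
  | nil => exact absurd rfl hv.2
  | cons i v => simp [shift, leftOf_cons]

theorem forestVertices_nil : forestVertices [] = ∅ := by
  ext u
  cases u <;> simp [forestVertices, cons_mem_vertices]

theorem forestVertices_cons (T : PlaneTree) (L : List PlaneTree) :
    forestVertices (T :: L) = List.cons 0 '' T.vertices ∪ shift '' forestVertices L := by
  ext u
  rcases u with _ | ⟨_ | i, u⟩
  · simp only [forestVertices, Set.mem_sdiff, Set.mem_singleton_iff, not_true_eq_false, and_false,
      Set.mem_union, Set.mem_image, false_iff, not_or, not_exists, not_and]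
    refine ⟨fun x _ => List.cons_ne_nil _ _, fun x hx h => ?_⟩
    cases x with
    | nil => exact hx.2 rfl
    | cons => simp [shift] at h
  · simp only [forestVertices, Set.mem_sdiff, cons_mem_vertices, Set.mem_union, Set.mem_image]
    constructor
    · rintro ⟨⟨t, ht, hu⟩, -⟩
      simp only [List.getElem?_cons_zero, Option.some.injEq] at ht
      exact Or.inl ⟨u, ht ▸ hu, rfl⟩
    · rintro (⟨x, hx, h⟩ | ⟨x, hx, h⟩)
      · cases h
        exact ⟨⟨T, rfl, hx⟩, by simp⟩
      · cases x <;> simp [shift] at h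
  · simp only [forestVertices, Set.mem_sdiff, cons_mem_vertices, Set.mem_union, Set.mem_image]
    constructor
    · rintro ⟨⟨t, ht, hu⟩, -⟩
      exact Or.inr ⟨i :: u, ⟨cons_mem_vertices.2 ⟨t, by simpa using ht, hu⟩, by simp⟩, rfl⟩
    · rintro (⟨x, hx, h⟩ | ⟨x, hx, h⟩)
      · cases h
      · rcases x with _ | ⟨j, x⟩
        · simp [shift] at h
        · simp only [shift, List.cons.injEq, Nat.add_right_cancel_iff] at h
          obtain ⟨rfl, rfl⟩ := h
          obtain ⟨t, ht, hu⟩ := cons_mem_vertices.1 hx.1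
          exact ⟨⟨t, by simpa using ht, hu⟩, by simp⟩

theorem vertices_node (L : List PlaneTree) : (node L).vertices = insert [] (forestVertices L) := by
  rw [forestVertices, Set.insert_sdiff_singleton, Set.insert_eq_of_mem (nil_mem_vertices _)]


theorem mem_vertices_of_below : ∀ {S : PlaneTree} {u w : List ℕ}, Below u w → u ∈ S.vertices →
    w ∈ S.vertices
  | S, _, [], _, _ => nil_mem_vertices S
  | _, [], i :: w, h, _ => absurd h (not_below_nil_cons i w)
  | node ss, j :: u, i :: w, h, hu => by
    obtain ⟨rfl, hw⟩ := below_cons.1 h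
    obtain ⟨t, ht, hu⟩ := cons_mem_vertices.1 hu
    exact cons_mem_vertices.2 ⟨t, ht, mem_vertices_of_below hw hu⟩

theorem zero_cons_mem_forestVertices {S : PlaneTree} {L : List PlaneTree} {u : List ℕ} :
    0 :: u ∈ forestVertices (S :: L) ↔ u ∈ S.vertices := by
  simp [forestVertices, cons_mem_vertices]

theorem shift_mem_forestVertices {S : PlaneTree} {L : List PlaneTree} {u : List ℕ}
    (hu : u ∈ forestVertices L) : shift u ∈ forestVertices (S :: L) := by
  rw [forestVertices_cons]
  exact Or.inr ⟨u, hu, rfl⟩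

theorem realizes_image : ∀ (L : List PlaneTree) (f : List ℕ → List ℕ),
    (∀ u ∈ forestVertices L, ∀ v ∈ forestVertices L, Below u v ↔ Below (f u) (f v)) →
    (∀ u ∈ forestVertices L, ∀ v ∈ forestVertices L, LeftOf u v → LeftOf (f u) (f v)) →
    Realizes L (f '' forestVertices L)
  | [], f, _, _ => by
    rw [forestVertices_nil, Set.image_empty]
    exact Realizes.nil
  | node ss :: L, f, hB, hL => by
    have h0 : ∀ u ∈ forestVertices ss, 0 :: u ∈ forestVertices (node ss :: L) := fun u hu =>
      zero_cons_mem_forestVertices.2 hu.1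
    have h0' : [0] ∈ forestVertices (node ss :: L) :=
      zero_cons_mem_forestVertices.2 (nil_mem_vertices _)
    have h1 : ∀ u ∈ forestVertices L, shift u ∈ forestVertices (node ss :: L) := fun u hu =>
      shift_mem_forestVertices hu
    have ih1 := realizes_image ss (fun u => f (0 :: u))
      (fun u hu v hv => by rw [← hB _ (h0 u hu) _ (h0 v hv), below_cons_left])
      (fun u hu v hv h => hL _ (h0 u hu) _ (h0 v hv) ((leftOf_cons_left 0 u v).2 h))
    have ih2 := realizes_image L (fun u => f (shift u))
      (fun u hu v hv => by rw [← hB _ (h1 u hu) _ (h1 v hv), below_shift])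
      (fun u hu v hv h => hL _ (h1 u hu) _ (h1 v hv) ((leftOf_shift u v).2 h))
    rw [forestVertices_cons, vertices_node, Set.image_insert_eq, Set.insert_union,
      Set.image_insert_eq, Set.image_union, Set.image_image, Set.image_image]
    refine Realizes.cons _ _ _ _ _ ih1 ih2 ?_ ?_
    · rintro _ ⟨u, hu, rfl⟩
      refine ⟨(hB _ (h0 u hu) _ h0').1 ((below_cons_left 0 u []).2 (below_nil u)), fun h => ?_⟩
      have h2 := (hB _ h0' _ (h0 u hu)).2 (h ▸ below_refl _)
      rw [below_cons_left] at h2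
      exact hu.2 (h2.antisymm (below_nil u)).symm
    · rintro _ ⟨u, hu, rfl⟩
      exact hL _ h0' _ (h1 u hu) (leftOf_zero_cons_shift [] hu)
termination_by L => sizeOf L

/-- The function that is `g` on the leftmost branch, and `h` on the other branches. -/
def glue (g h : List ℕ → List ℕ) : List ℕ → List ℕ
  | [] => []
  | 0 :: u => g u
  | (i + 1) :: u => h (i :: u)

theorem glue_shift (g h : List ℕ → List ℕ) {L : List PlaneTree} {u : List ℕ}
    (hu : u ∈ forestVertices L) : glue g h (shift u) = h u := by
  cases u with
  | nil => exact absurd rfl hu.2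
  | cons i u => rfl

theorem not_below_zero_cons_shift {L : List PlaneTree} {u v : List ℕ}
    (hv : v ∈ forestVertices L) : ¬ Below (0 :: u) (shift v) :=
  (leftOf_zero_cons_shift u hv).not_below

theorem not_below_shift_zero_cons {L : List PlaneTree} {u v : List ℕ}
    (hv : v ∈ forestVertices L) : ¬ Below (shift v) (0 :: u) :=
  (leftOf_zero_cons_shift u hv).not_above

theorem not_leftOf_shift_zero_cons {L : List PlaneTree} {u v : List ℕ}
    (hv : v ∈ forestVertices L) : ¬ LeftOf (shift v) (0 :: u) :=
  (leftOf_zero_cons_shift u hv).asymm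

/-- Converse of `realizes_image`: the map is assembled along the construction of the copy, root
first, then the branches below it, then the trees to its right. -/
theorem Realizes.exists_image {L : List PlaneTree} {X : Set (List ℕ)} (h : Realizes L X) :
    ∃ f : List ℕ → List ℕ, X = f '' forestVertices L ∧
      (∀ u ∈ forestVertices L, ∀ v ∈ forestVertices L, Below u v ↔ Below (f u) (f v)) ∧
      (∀ u ∈ forestVertices L, ∀ v ∈ forestVertices L, LeftOf u v → LeftOf (f u) (f v)) := by
  induction h with
  | nil => exact ⟨id, by simp [forestVertices_nil], by simp [forestVertices_nil],
      by simp [forestVertices_nil]⟩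
  | cons r ss L X Y h₁ h₂ hr hl ih₁ ih₂ =>
    obtain ⟨f, rfl, fB, fL⟩ := ih₁
    obtain ⟨g, rfl, gB, gL⟩ := ih₂
    classical
    let f' : List ℕ → List ℕ := fun u => if u = [] then r else f u
    have f'0 : f' [] = r := if_pos rfl
    have f'1 : ∀ u ∈ forestVertices ss, f' u = f u := fun u hu => if_neg hu.2
    have hr' : ∀ u ∈ forestVertices ss, ¬ Below r (f u) := fun u hu h =>
      (hr _ ⟨u, hu, rfl⟩).2 ((hr _ ⟨u, hu, rfl⟩).1.antisymm h)
    have f'B : ∀ u ∈ (node ss).vertices, ∀ v ∈ (node ss).vertices,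
        Below u v ↔ Below (f' u) (f' v) := by
      rw [vertices_node]
      rintro u (rfl | hu) v (rfl | hv)
      · simp [below_refl]
      · rw [f'0, f'1 v hv]
        exact iff_of_false (fun h => hv.2 ((below_nil v).antisymm h)) (hr' v hv)
      · rw [f'0, f'1 u hu]
        exact iff_of_true (below_nil u) (hr _ ⟨u, hu, rfl⟩).1
      · rw [f'1 u hu, f'1 v hv]
        exact fB u hu v hv
    have f'L : ∀ u ∈ (node ss).vertices, ∀ v ∈ (node ss).vertices,
        LeftOf u v → LeftOf (f' u) (f' v) := by
      rw [vertices_node]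
      rintro u (rfl | hu) v (rfl | hv) h
      · exact absurd h (not_leftOf_nil_left _)
      · exact absurd h (not_leftOf_nil_left _)
      · exact absurd h (not_leftOf_nil_right _)
      · rw [f'1 u hu, f'1 v hv]
        exact fL u hu v hv h
    have hfg : ∀ u ∈ (node ss).vertices, ∀ v ∈ forestVertices L, LeftOf (f' u) (g v) := by
      rw [vertices_node]
      rintro u (rfl | hu) v hv
      · rw [f'0]
        exact hl _ ⟨v, hv, rfl⟩
      · rw [f'1 u hu]
        exact (hl _ ⟨v, hv, rfl⟩).mono (hr _ ⟨u, hu, rfl⟩).1 (below_refl _)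
    refine ⟨glue f' g, ?_, ?_, ?_⟩
    · rw [forestVertices_cons, Set.image_union, Set.image_image, Set.image_image,
        Set.image_congr fun u (hu : u ∈ forestVertices L) => glue_shift f' g hu, vertices_node]
      change _ = f' '' _ ∪ _
      rw [Set.image_insert_eq, Set.image_congr f'1, f'0, Set.insert_union]
    · rw [forestVertices_cons]
      rintro _ (⟨u, hu, rfl⟩ | ⟨u, hu, rfl⟩) _ (⟨v, hv, rfl⟩ | ⟨v, hv, rfl⟩)
      · rw [below_cons_left]
        exact f'B u hu v hv
      · rw [glue_shift f' g hv]
        exact iff_of_false (not_below_zero_cons_shift hv) (hfg u hu v hv).not_below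
      · rw [glue_shift f' g hu]
        exact iff_of_false (not_below_shift_zero_cons hu) (hfg v hv u hu).not_above
      · rw [glue_shift f' g hu, glue_shift f' g hv, below_shift]
        exact gB u hu v hv
    · rw [forestVertices_cons]
      rintro _ (⟨u, hu, rfl⟩ | ⟨u, hu, rfl⟩) _ (⟨v, hv, rfl⟩ | ⟨v, hv, rfl⟩) h
      · exact f'L u hu v hv ((leftOf_cons_left 0 u v).1 h)
      · rw [glue_shift f' g hv]
        exact hfg u hu v hv
      · exact absurd h (not_leftOf_shift_zero_cons hu)
      · rw [glue_shift f' g hu, glue_shift f' g hv]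
        exact gL u hu v hv ((leftOf_shift u v).1 h)

theorem forestVertices_singleton (S : PlaneTree) :
    forestVertices [S] = List.cons 0 '' S.vertices := by
  rw [forestVertices_cons, forestVertices_nil, Set.image_empty, Set.union_empty]

theorem isEmbedding_iff {S T : PlaneTree} {X : Set (List ℕ)} :
    IsEmbedding S T X ↔ X ⊆ T.vertices ∧ Realizes [S] X := by
  refine and_congr_right fun _ => ⟨?_, fun h => ?_⟩
  · rintro ⟨f, hB, hL⟩
    classical
    let g : List ℕ → List ℕ := fun u =>
      if h : u.tail ∈ S.vertices then (f ⟨u.tail, h⟩ : List ℕ) else []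
    have hg : ∀ u (hu : u ∈ S.vertices), g (0 :: u) = f ⟨u, hu⟩ := fun u hu => dif_pos hu
    have := realizes_image [S] g (by
      rw [forestVertices_singleton]
      rintro _ ⟨u, hu, rfl⟩ _ ⟨v, hv, rfl⟩
      rw [below_cons_left, hg u hu, hg v hv]
      exact hB ⟨u, hu⟩ ⟨v, hv⟩) (by
      rw [forestVertices_singleton]
      rintro _ ⟨u, hu, rfl⟩ _ ⟨v, hv, rfl⟩ h
      rw [hg u hu, hg v hv]
      -- Only siblings are compared in `IsEmbedding`. Two vertices in left-to-right order lie below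
      -- two siblings, and the order of the images of these siblings is inherited by whatever lies
      -- below them.
      obtain ⟨p, i, j, hij, hi, hj⟩ := (leftOf_cons_left 0 u v).1 h
      have hi' := mem_vertices_of_below hi hu
      have hj' := mem_vertices_of_below hj hv
      exact (hL p i j hi' hj' hij).mono ((hB ⟨u, hu⟩ ⟨_, hi'⟩).1 hi)
        ((hB ⟨v, hv⟩ ⟨_, hj'⟩).1 hj))
    convert this
    rw [forestVertices_singleton, Set.image_image]
    ext x
    constructor
    · intro hx
      refine ⟨f.symm ⟨x, hx⟩, (f.symm ⟨x, hx⟩).2, ?_⟩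
      simp only
      rw [hg _ (f.symm ⟨x, hx⟩).2]
      simp
    · rintro ⟨u, hu, rfl⟩
      simp only
      rw [hg u hu]
      exact (f ⟨u, hu⟩).2
  · obtain ⟨f, rfl, hB, hL⟩ := h.exists_image
    simp only [forestVertices_singleton, Set.forall_mem_image, below_cons_left,
      leftOf_cons_left] at hB hL
    rw [forestVertices_singleton, Set.image_image]
    have hinj : Set.InjOn (fun u => f (0 :: u)) S.vertices := fun u hu v hv h =>
      ((hB hu hv).2 (by simp only at h; rw [h]; exact below_refl _)).antisymm
        ((hB hv hu).2 (by simp only at h; rw [h]; exact below_refl _))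
    refine ⟨Equiv.Set.imageOfInjOn _ _ hinj, fun u v => hB u.2 v.2, fun p i j hi hj hij => ?_⟩
    exact hL hi hj ⟨p, i, j, hij, below_refl _, below_refl _⟩

/-! ### Recursions for sizes and numbers of copies -/

theorem size_node_nil : size (node []) = 1 := by
  rw [size, vertices_node, forestVertices_nil]
  simp

theorem size_node_cons (T : PlaneTree) (L : List PlaneTree) :
    size (node (T :: L)) = size T + size (node L) := by
  have h1 : (node (T :: L)).vertices = List.cons 0 '' T.vertices ∪ shift '' (node L).vertices := by
    rw [vertices_node, vertices_node L, forestVertices_cons, Set.image_insert_eq,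
      Set.union_insert]
    rfl
  have hd : Disjoint (List.cons 0 '' T.vertices) (shift '' (node L).vertices) := by
    rw [Set.disjoint_left]
    rintro _ ⟨u, -, rfl⟩ ⟨v, -, h⟩
    cases v <;> simp [shift] at h
  rw [size, h1, Set.ncard_union_eq hd ((finite_vertices T).image _)
    ((finite_vertices (node L)).image _), Set.ncard_image_of_injective _ List.cons_injective,
    Set.ncard_image_of_injective _ shift_injective]
  rfl

theorem size_pos (T : PlaneTree) : 0 < T.size :=
  (Set.ncard_pos (finite_vertices T)).2 ⟨[], nil_mem_vertices T⟩

/-- The number of copies of the forest `L` in the tree `T`. -/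
noncomputable def treeCount (L : List PlaneTree) (T : PlaneTree) : ℕ :=
  {X | X ⊆ T.vertices ∧ Realizes L X}.ncard

/-- The number of copies of the forest `L` in the forest `M`. -/
noncomputable def forestCount (L M : List PlaneTree) : ℕ :=
  {X | X ⊆ forestVertices M ∧ Realizes L X}.ncard

theorem finite_forestVertices (M : List PlaneTree) : (forestVertices M).Finite :=
  (finite_vertices (node M)).sdiff

theorem finite_copies {V : Set (List ℕ)} (hV : V.Finite) (L : List PlaneTree) :
    {X | X ⊆ V ∧ Realizes L X}.Finite :=
  hV.finite_subsets.subset fun _ hX => hX.1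

theorem allCount_eq (T S : PlaneTree) : allCount T S = treeCount [S] T := by
  simp only [allCount, treeCount, isEmbedding_iff]

theorem Realizes.nil_mem {L : List PlaneTree} {X : Set (List ℕ)} (h : Realizes L X)
    (hX : [] ∈ X) : ∃ ss, L = [node ss] ∧ Realizes ss (X \ {[]}) := by
  cases h with
  | nil => exact absurd hX (Set.notMem_empty _)
  | cons r ss L X Y h₁ h₂ hr hl =>
    have hr0 : r = [] := by
      rcases hX with h | h | h
      · exact h.symm
      · exact (below_nil r).antisymm (hr _ h).1
      · exact absurd (hl _ h) (not_leftOf_nil_right _)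
    subst hr0
    have hY : Y = ∅ := Set.eq_empty_of_forall_notMem fun y hy => not_leftOf_nil_left _ (hl y hy)
    subst hY
    obtain rfl := h₂.eq_nil
    have hX0 : [] ∉ X := fun h => (hr _ h).2 rfl
    refine ⟨ss, rfl, ?_⟩
    rwa [Set.union_empty, Set.insert_sdiff_self_of_notMem hX0]

theorem goodCount_eq (M ss : List PlaneTree) :
    goodCount (node M) (node ss) = forestCount ss M := by
  have hni : [] ∉ forestVertices M := fun h => h.2 rfl
  have hset : {X | IsEmbedding (node ss) (node M) X ∧ [] ∈ X} =
      insert [] '' {X | X ⊆ forestVertices M ∧ Realizes ss X} := by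
    ext X
    simp only [isEmbedding_iff, Set.mem_ofPred_eq, Set.mem_image]
    constructor
    · rintro ⟨⟨hX, h⟩, h0⟩
      obtain ⟨ss', h1, h2⟩ := h.nil_mem h0
      cases h1
      exact ⟨X \ {[]}, ⟨Set.sdiff_subset_sdiff_left hX, h2⟩, by
        rw [Set.insert_sdiff_singleton, Set.insert_eq_of_mem h0]⟩
    · rintro ⟨X, ⟨hX, h⟩, rfl⟩
      refine ⟨⟨?_, ?_⟩, Set.mem_insert _ _⟩
      · rw [vertices_node]
        exact Set.insert_subset_insert hX
      · have := Realizes.cons [] ss [] X ∅ h Realizes.nil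
          (fun x hx => ⟨below_nil x, fun h => hni (h ▸ hX hx)⟩) (by simp)
        rwa [Set.union_empty] at this
  rw [goodCount, hset, forestCount]
  refine Set.InjOn.ncard_image fun X hX Y hY h => ?_
  have hX0 : [] ∉ X := fun h => hni (hX.1 h)
  have hY0 : [] ∉ Y := fun h => hni (hY.1 h)
  rw [← Set.insert_sdiff_self_of_notMem hX0, h, Set.insert_sdiff_self_of_notMem hY0]

theorem treeCount_eq (L M : List PlaneTree) :
    treeCount L (node M) =
      forestCount L M + {X | (X ⊆ (node M).vertices ∧ Realizes L X) ∧ [] ∈ X}.ncard := by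
  have hset : {X | X ⊆ (node M).vertices ∧ Realizes L X} =
      {X | X ⊆ forestVertices M ∧ Realizes L X} ∪
        {X | (X ⊆ (node M).vertices ∧ Realizes L X) ∧ [] ∈ X} := by
    ext X
    have : X ⊆ forestVertices M ↔ X ⊆ (node M).vertices ∧ [] ∉ X := by
      rw [forestVertices, Set.subset_sdiff, Set.disjoint_singleton_right]
    simp only [Set.mem_ofPred_eq, Set.mem_union, this]
    tauto
  have hfin := finite_copies (finite_vertices (node M)) L
  rw [treeCount, hset, Set.ncard_union_eq ?_ (finite_copies (finite_forestVertices M) L)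
    (hfin.subset fun X hX => hX.1)]
  · rfl
  · rw [Set.disjoint_left]
    exact fun X h1 h2 => (h1.1 h2.2).2 rfl

/-- The root of the host is comparable to every vertex, so a copy that uses it is a single tree. -/
theorem treeCount_of_length_ne_one {L : List PlaneTree} (hL : L.length ≠ 1)
    (M : List PlaneTree) : treeCount L (node M) = forestCount L M := by
  rw [treeCount_eq, Nat.add_eq_left, Set.ncard_eq_zero
    ((finite_copies (finite_vertices (node M)) L).subset fun X hX => hX.1)]
  refine Set.eq_empty_of_forall_notMem fun X hX => hL ?_
  obtain ⟨ss, rfl, -⟩ := hX.1.2.nil_mem hX.2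
  rfl

theorem treeCount_singleton (ss M : List PlaneTree) :
    treeCount [node ss] (node M) = forestCount [node ss] M + forestCount ss M := by
  rw [treeCount_eq, ← goodCount_eq M ss]
  simp only [goodCount, isEmbedding_iff]

theorem forestCount_nil_right (L : List PlaneTree) :
    forestCount L [] = if L = [] then 1 else 0 := by
  have : {X | X ⊆ forestVertices [] ∧ Realizes L X} = if L = [] then {∅} else ∅ := by
    ext X
    rw [forestVertices_nil]
    simp only [Set.subset_empty_iff, Set.mem_ofPred_eq]
    split_ifs with h
    · subst h
      simp only [Set.mem_singleton_iff, and_iff_left_iff_imp]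
      rintro rfl
      exact Realizes.nil
    · simp only [Set.mem_empty_iff_false, iff_false, not_and]
      rintro rfl h'
      exact h h'.eq_nil
  rw [forestCount, this]
  split_ifs <;> simp

/-- Everything in the leftmost branch is to the left of everything else, so a copy of `L` is cut
there into copies of a prefix and of the complementary suffix; the copy determines the cut. -/
theorem forestCount_cons (L : List PlaneTree) (T : PlaneTree) (M : List PlaneTree) :
    forestCount L (T :: M) = ∑ k ∈ Finset.range (L.length + 1),
      treeCount (L.take k) T * forestCount (L.drop k) M := by
  let A : ℕ → Set (Set (List ℕ)) := fun k => {X | X ⊆ T.vertices ∧ Realizes (L.take k) X}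
  let B : ℕ → Set (Set (List ℕ)) := fun k => {X | X ⊆ forestVertices M ∧ Realizes (L.drop k) X}
  let φ : Set (List ℕ) × Set (List ℕ) → Set (List ℕ) := fun P =>
    List.cons 0 '' P.1 ∪ shift '' P.2
  have hφ1 : ∀ P, List.cons 0 ⁻¹' φ P = P.1 := by
    intro P
    ext u
    simp only [φ, Set.mem_preimage, Set.mem_union, Set.mem_image]
    constructor
    · rintro (⟨v, hv, h⟩ | ⟨v, hv, h⟩)
      · cases h
        exact hv
      · cases v <;> simp [shift] at h
    · exact fun hu => Or.inl ⟨u, hu, rfl⟩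
  have hφ2 : ∀ P, shift ⁻¹' φ P = P.2 := by
    intro P
    ext u
    simp only [φ, Set.mem_preimage, Set.mem_union, Set.mem_image]
    constructor
    · rintro (⟨v, hv, h⟩ | ⟨v, hv, h⟩)
      · cases u <;> simp [shift] at h
      · exact shift_injective h ▸ hv
    · exact fun hu => Or.inr ⟨u, hu, rfl⟩
  have hφ : Function.Injective φ := fun P Q h =>
    Prod.ext (by rw [← hφ1, h, hφ1]) (by rw [← hφ2, h, hφ2])
  have hset : {X | X ⊆ forestVertices (T :: M) ∧ Realizes L X} =
      ⋃ k ∈ Finset.range (L.length + 1), φ '' (A k ×ˢ B k) := by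
    ext X
    simp only [Set.mem_ofPred_eq, Set.mem_iUnion, Finset.mem_range, Set.mem_image, Set.mem_prod,
      exists_prop]
    rw [forestVertices_cons]
    constructor
    · rintro ⟨hX, h⟩
      obtain ⟨P, Q, rfl, hP, hQ⟩ := h.split hX (by
        rintro _ ⟨u, -, rfl⟩ _ ⟨v, hv, rfl⟩
        exact leftOf_zero_cons_shift u hv)
      have h1 : List.cons 0 '' (List.cons 0 ⁻¹' (X ∩ List.cons 0 '' T.vertices)) =
          X ∩ List.cons 0 '' T.vertices :=
        Set.image_preimage_eq_of_subset (Set.inter_subset_right.trans (Set.image_subset_range _ _))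
      have h2 : shift '' (shift ⁻¹' (X ∩ shift '' forestVertices M)) =
          X ∩ shift '' forestVertices M :=
        Set.image_preimage_eq_of_subset (Set.inter_subset_right.trans (Set.image_subset_range _ _))
      refine ⟨P.length, by simp, (List.cons 0 ⁻¹' (X ∩ List.cons 0 '' T.vertices),
        shift ⁻¹' (X ∩ shift '' forestVertices M)), ⟨⟨?_, ?_⟩, ?_, ?_⟩, ?_⟩
      · rintro u ⟨-, v, hv, h⟩
        cases h
        exact hv
      · rw [List.take_left]
        exact hP.preimage (below_cons_left 0) (leftOf_cons_left 0)
          (Set.inter_subset_right.trans (Set.image_subset_range _ _))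
      · rintro u ⟨-, v, hv, h⟩
        exact shift_injective h ▸ hv
      · rw [List.drop_left]
        exact hQ.preimage below_shift leftOf_shift
          (Set.inter_subset_right.trans (Set.image_subset_range _ _))
      · simp only [φ]
        rw [h1, h2, ← Set.inter_union_distrib_left, Set.inter_eq_left.2 hX]
    · rintro ⟨k, -, ⟨Y, Z⟩, ⟨⟨hY, hY'⟩, hZ, hZ'⟩, rfl⟩
      refine ⟨Set.union_subset_union (Set.image_mono hY) (Set.image_mono hZ), ?_⟩
      rw [← List.take_append_drop k L]
      refine (hY'.image (below_cons_left 0) (leftOf_cons_left 0)).append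
        (hZ'.image below_shift leftOf_shift) ?_
      rintro _ ⟨u, -, rfl⟩ _ ⟨v, hv, rfl⟩
      exact leftOf_zero_cons_shift u (hZ hv)
  have hA : ∀ k, (A k).Finite := fun k => finite_copies (finite_vertices T) _
  have hB : ∀ k, (B k).Finite := fun k => finite_copies (finite_forestVertices M) _
  rw [forestCount, hset]
  have := Set.Finite.ncard_biUnion (Finset.range (L.length + 1)).finite_toSet
    (s := fun k => φ '' (A k ×ˢ B k)) (fun k _ => ((hA k).prod (hB k)).image _) (by
      intro k hk l hl hkl
      simp only [Finset.coe_range, Set.mem_Iio] at hk hl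
      refine Set.disjoint_left.2 ?_
      rintro _ ⟨P, hP, rfl⟩ ⟨Q, hQ, h⟩
      obtain rfl := hφ h
      have := congrArg List.length (hP.1.2.unique hQ.1.2)
      simp only [List.length_take] at this
      omega)
  rw [finsum_mem_coe_finset] at this
  simp only [Finset.mem_coe] at this
  rw [this]
  refine Finset.sum_congr rfl fun k _ => ?_
  rw [Set.ncard_image_of_injective _ hφ, Set.ncard_prod]
  rfl


/-! ### Generating functions -/

/-- The list of the branches at the root. -/
def branches : PlaneTree → List PlaneTree
  | node M => M

theorem branches_node (M : List PlaneTree) : (node M).branches = M := rfl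

theorem mem_plantedTrees {n : ℕ} {T : PlaneTree} : T ∈ plantedTrees n ↔ T.size = n := by
  simp [plantedTrees]

/-- A tree with more than one vertex is the pair of its leftmost branch and the tree that remains,
and the two sizes add up. -/
theorem sum_plantedTrees (f : PlaneTree → ℝ) (n : ℕ) :
    ∑ T ∈ plantedTrees n, f T = (if n = 1 then f (node []) else 0) +
      ∑ p ∈ Finset.HasAntidiagonal.antidiagonal n, ∑ T ∈ plantedTrees p.1, ∑ U ∈ plantedTrees p.2,
        f (node (T :: U.branches)) := by
  classical
  rw [← Finset.sum_filter_add_sum_filter_not (plantedTrees n) (fun T => T = node [])]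
  congr 1
  · have : (plantedTrees n).filter (fun T => T = node []) = if n = 1 then {node []} else ∅ := by
      ext T
      simp only [Finset.mem_filter, mem_plantedTrees]
      split_ifs with h
      · subst h
        simp only [Finset.mem_singleton, and_iff_right_iff_imp]
        rintro rfl
        exact size_node_nil
      · simp only [Finset.notMem_empty, iff_false, not_and]
        rintro rfl rfl
        exact h size_node_nil
    rw [this]
    split_ifs <;> simp
  · simp_rw [← Finset.sum_product']
    rw [Finset.sum_sigma']
    symm
    refine Finset.sum_bij (fun x _ => node (x.2.1 :: x.2.2.branches)) ?_ ?_ ?_ ?_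
    · rintro ⟨⟨i, j⟩, T, ⟨M⟩⟩ h
      simp only [Finset.mem_sigma, Finset.HasAntidiagonal.mem_antidiagonal, Finset.mem_product,
        mem_plantedTrees] at h
      simp only [Finset.mem_filter, mem_plantedTrees, branches, node.injEq, reduceCtorEq,
        not_false_eq_true, and_true, size_node_cons]
      omega
    · rintro ⟨⟨i, j⟩, T, ⟨M⟩⟩ h ⟨⟨i', j'⟩, T', ⟨M'⟩⟩ h' hh
      simp only [Finset.mem_sigma, Finset.HasAntidiagonal.mem_antidiagonal, Finset.mem_product,
        mem_plantedTrees] at h h'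
      simp only [branches, node.injEq, List.cons.injEq] at hh
      obtain ⟨rfl, rfl⟩ := hh
      obtain ⟨-, rfl, rfl⟩ := h
      obtain ⟨-, rfl, rfl⟩ := h'
      rfl
    · rintro ⟨_ | ⟨T, M⟩⟩ h
      · simp at h
      · simp only [Finset.mem_filter, mem_plantedTrees, size_node_cons] at h
        refine ⟨⟨(T.size, (node M).size), T, node M⟩, ?_, rfl⟩
        simp [mem_plantedTrees, h.1]
    · intros
      rfl

open PowerSeries

/-- The generating function of the copies of the forest `L` in plane trees. -/
noncomputable def treeSeries (L : List PlaneTree) : ℝ⟦X⟧ :=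
  mk fun n => ∑ T ∈ plantedTrees n, (treeCount L T : ℝ)

/-- The generating function of the copies of the forest `L` in plane trees that avoid the root. -/
noncomputable def forestSeries (L : List PlaneTree) : ℝ⟦X⟧ :=
  mk fun n => ∑ T ∈ plantedTrees n, (forestCount L T.branches : ℝ)

/-- The generating function of the good embeddings of `S` into plane trees. -/
noncomputable def rootSeries (S : PlaneTree) : ℝ⟦X⟧ := forestSeries S.branches

theorem coeff_rootSeries (S : PlaneTree) (n : ℕ) : coeff n (rootSeries S) = goodTotal n S := by
  obtain ⟨ss⟩ := S
  rw [rootSeries, forestSeries, coeff_mk, goodTotal, Nat.cast_sum]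
  refine Finset.sum_congr rfl ?_
  rintro ⟨M⟩ -
  rw [goodCount_eq]
  rfl

theorem coeff_treeSeries (S : PlaneTree) (n : ℕ) : coeff n (treeSeries [S]) = allTotal n S := by
  rw [treeSeries, coeff_mk, allTotal, Nat.cast_sum]
  exact Finset.sum_congr rfl fun T _ => by rw [allCount_eq]

theorem treeSeries_of_length_ne_one {L : List PlaneTree} (hL : L.length ≠ 1) :
    treeSeries L = forestSeries L := by
  ext n
  rw [treeSeries, forestSeries, coeff_mk, coeff_mk]
  refine Finset.sum_congr rfl ?_
  rintro ⟨M⟩ -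
  rw [treeCount_of_length_ne_one hL]
  rfl

theorem treeSeries_singleton (S : PlaneTree) :
    treeSeries [S] = forestSeries [S] + rootSeries S := by
  obtain ⟨ss⟩ := S
  ext n
  rw [map_add, rootSeries, treeSeries, forestSeries, forestSeries, coeff_mk, coeff_mk, coeff_mk,
    ← Finset.sum_add_distrib]
  refine Finset.sum_congr rfl ?_
  rintro ⟨M⟩ -
  rw [treeCount_singleton]
  push_cast
  rfl

theorem forestSeries_eq (L : List PlaneTree) :
    forestSeries L = (if L = [] then X else 0) + ∑ k ∈ Finset.range (L.length + 1),
      treeSeries (L.take k) * forestSeries (L.drop k) := by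
  ext n
  rw [forestSeries, coeff_mk, sum_plantedTrees, map_add, map_sum]
  congr 1
  · rw [branches, forestCount_nil_right]
    split_ifs <;> simp_all [coeff_X]
  · simp_rw [coeff_mul]
    rw [Finset.sum_comm]
    refine Finset.sum_congr rfl fun p _ => ?_
    simp_rw [treeSeries, forestSeries, coeff_mk, Finset.sum_mul_sum, branches_node,
      forestCount_cons, Nat.cast_sum, Nat.cast_mul]
    symm
    rw [Finset.sum_comm]
    exact Finset.sum_congr rfl fun T _ => Finset.sum_comm

/-! ### The Catalan series and the factorisation over branches -/

/-- The generating function of plane trees. -/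
noncomputable def catalanSeries : ℝ⟦X⟧ := forestSeries []

/-- The square root of `1 - 4 X`. -/
noncomputable def sqrtSeries : ℝ⟦X⟧ := 1 - 2 * catalanSeries

/-- The inverse square root of `1 - 4 X`. -/
noncomputable def invSqrtSeries : ℝ⟦X⟧ := sqrtSeries⁻¹

theorem catalanSeries_eq : catalanSeries = X + catalanSeries * catalanSeries := by
  conv_lhs => rw [catalanSeries, forestSeries_eq]
  simp [treeSeries_of_length_ne_one, catalanSeries]

theorem sqrtSeries_mul_self : sqrtSeries * sqrtSeries = 1 - 4 * X := by
  have := catalanSeries_eq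
  rw [sqrtSeries]
  linear_combination (-4) * this

theorem constantCoeff_catalanSeries : constantCoeff catalanSeries = 0 := by
  rw [← coeff_zero_eq_constantCoeff_apply, catalanSeries, forestSeries, coeff_mk]
  refine Finset.sum_eq_zero fun T hT => ?_
  have := size_pos T
  rw [mem_plantedTrees] at hT
  omega

theorem constantCoeff_sqrtSeries : constantCoeff sqrtSeries = 1 := by
  simp [sqrtSeries, constantCoeff_catalanSeries]

theorem sqrtSeries_mul_invSqrtSeries : sqrtSeries * invSqrtSeries = 1 :=
  PowerSeries.mul_inv_cancel _ (by simp [constantCoeff_sqrtSeries])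

theorem constantCoeff_invSqrtSeries : constantCoeff invSqrtSeries = 1 := by
  simp [invSqrtSeries, constantCoeff_sqrtSeries]

/-- The generating function of plane trees with `k` marked incomparable vertices other than the
root, whose subtrees are deleted. -/
noncomputable def markedSeries : ℕ → ℝ⟦X⟧
  | 0 => catalanSeries
  | k + 1 => invSqrtSeries * (markedSeries k +
      ∑ i : Fin k, markedSeries (i + 1) * markedSeries (k - i))
decreasing_by all_goals omega

theorem markedSeries_zero : markedSeries 0 = catalanSeries := by
  rw [markedSeries]

theorem markedSeries_succ (k : ℕ) : markedSeries (k + 1) = invSqrtSeries * (markedSeries k +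
    ∑ i ∈ Finset.range k, markedSeries (i + 1) * markedSeries (k - i)) := by
  rw [markedSeries, Finset.sum_range (fun i => markedSeries (i + 1) * markedSeries (k - i))]

/-- The terms of `forestSeries_eq` in which the leftmost branch meets none or all of `L` reproduce
$2CF$. Moving them to the left leaves $(1-2C)F=wF$, whence the factor `invSqrtSeries` in
`markedSeries`. -/
theorem forestSeries_eq_markedSeries (k : ℕ) : ∀ L : List PlaneTree, L.length = k →
    forestSeries L = markedSeries k * (L.map rootSeries).prod := by
  induction k using Nat.strong_induction_on with
  | _ k ih =>
    rintro (_ | ⟨S, L⟩) hL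
    · obtain rfl : k = 0 := by simpa using hL.symm
      simp [markedSeries_zero, catalanSeries]
    · obtain rfl : k = L.length + 1 := by simpa using hL.symm
      set F := forestSeries (S :: L) with hF
      set P := ((S :: L).map rootSeries).prod with hP
      have h1 : ∀ i ∈ Finset.range L.length,
          treeSeries ((S :: L).take (i + 1)) * forestSeries ((S :: L).drop (i + 1)) =
            (markedSeries (i + 1) * markedSeries (L.length - i)) * P +
              if i = 0 then rootSeries S * forestSeries L else 0 := by
        intro i hi
        rw [Finset.mem_range] at hi
        have e1 : treeSeries ((S :: L).take (i + 1)) = forestSeries ((S :: L).take (i + 1)) +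
            if i = 0 then rootSeries S else 0 := by
          split_ifs with h
          · subst h
            simp [treeSeries_singleton]
          · rw [add_zero, treeSeries_of_length_ne_one]
            simp only [List.length_take, List.length_cons]
            omega
        rw [e1, add_mul]
        congr 1
        · rw [ih (i + 1) (by omega) _ (by simp; omega),
            ih (L.length - i) (by omega) _ (by simp), hP, ← List.take_append_drop (i + 1) (S :: L),
            List.map_append, List.prod_append, List.take_append_drop]
          ring
        · split_ifs with h
          · subst h
            simp
          · simp
      have hL' := ih L.length (by omega) L rfl
      have key : F = 2 * catalanSeries * F + markedSeries L.length * P +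
          (∑ i ∈ Finset.range L.length, markedSeries (i + 1) * markedSeries (L.length - i)) * P := by
        have h2 := forestSeries_eq (S :: L)
        rw [if_neg (List.cons_ne_nil _ _), zero_add, List.length_cons, Finset.sum_range_succ',
          Finset.sum_range_succ, Finset.sum_congr rfl h1, Finset.sum_add_distrib,
          ← Finset.sum_mul] at h2
        have hP' : P = rootSeries S * (L.map rootSeries).prod := by simp [hP]
        have e0 : treeSeries ((S :: L).take 0) * forestSeries ((S :: L).drop 0) =
            catalanSeries * F := by
          simp [treeSeries_of_length_ne_one, catalanSeries, hF]
        -- The contribution where the root of the leftmost branch is used by `S` is the summand `i =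
        -- 0` if `L` is nonempty, and is hidden in the last term if `L` is empty.
        have e3 : (∑ i ∈ Finset.range L.length,
            if i = 0 then rootSeries S * forestSeries L else 0) +
            treeSeries ((S :: L).take (L.length + 1)) * forestSeries ((S :: L).drop (L.length + 1)) =
            F * catalanSeries + markedSeries L.length * P := by
          have e4 : (S :: L).take (L.length + 1) = S :: L := by simp
          have e5 : (S :: L).drop (L.length + 1) = [] := by simp
          rw [e4, e5, hP']
          rcases L with _ | ⟨S', L⟩
          · simp [treeSeries_singleton, hF, catalanSeries, markedSeries_zero]
            ring
          · rw [treeSeries_of_length_ne_one (by simp), Finset.sum_ite_eq' , if_pos (by simp), hL', hF,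
              catalanSeries]
            ring
        rw [e0] at h2
        rw [← hF] at h2
        linear_combination h2 + e3
      have h3 : sqrtSeries * F = (markedSeries L.length +
          ∑ i ∈ Finset.range L.length, markedSeries (i + 1) * markedSeries (L.length - i)) * P := by
        rw [sqrtSeries]
        linear_combination key
      rw [markedSeries_succ]
      linear_combination (-F) * sqrtSeries_mul_invSqrtSeries + invSqrtSeries * h3

/-! ### Orders of the singularities -/

/-- `Leading j F` says that `F`, as a function of `w = √(1 - 4 X)`, is `w ^ (-j)` times a polynomial
with a positive constant term. -/
def Leading (j : ℕ) (F : ℝ⟦X⟧) : Prop :=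
  ∃ p : Polynomial ℝ, 0 < p.coeff 0 ∧ F = invSqrtSeries ^ j * Polynomial.aeval sqrtSeries p

theorem leading_one : Leading 0 1 := ⟨1, by simp, by simp⟩

theorem Leading.mul {i j : ℕ} {F G : ℝ⟦X⟧} (hF : Leading i F) (hG : Leading j G) :
    Leading (i + j) (F * G) := by
  obtain ⟨p, hp, rfl⟩ := hF
  obtain ⟨q, hq, rfl⟩ := hG
  exact ⟨p * q, by rw [Polynomial.mul_coeff_zero]; positivity, by rw [map_mul]; ring⟩

theorem Leading.add {j : ℕ} {F G : ℝ⟦X⟧} (hF : Leading j F) (hG : Leading j G) :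
    Leading j (F + G) := by
  obtain ⟨p, hp, rfl⟩ := hF
  obtain ⟨q, hq, rfl⟩ := hG
  exact ⟨p + q, by rw [Polynomial.coeff_add]; positivity, by rw [map_add]; ring⟩

/-- Rewriting $w^{-j}p$ as $w^{-(j+1)}\cdot wp$ leaves the constant term of the sum unchanged. -/
theorem Leading.lower_add {j : ℕ} {F G : ℝ⟦X⟧} (hF : Leading j F) (hG : Leading (j + 1) G) :
    Leading (j + 1) (F + G) := by
  obtain ⟨p, hp, rfl⟩ := hF
  obtain ⟨q, hq, rfl⟩ := hG
  refine ⟨Polynomial.X * p + q, by simpa using hq, ?_⟩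
  rw [map_add, map_mul, Polynomial.aeval_X]
  linear_combination (-invSqrtSeries ^ j * Polynomial.aeval sqrtSeries p) *
    sqrtSeries_mul_invSqrtSeries

theorem Leading.sum_range {j : ℕ} {F : ℕ → ℝ⟦X⟧} {n : ℕ} (h : ∀ i ≤ n, Leading j (F i)) :
    Leading j (∑ i ∈ Finset.range (n + 1), F i) := by
  induction n with
  | zero => simpa using h 0 le_rfl
  | succ n ih =>
    rw [Finset.sum_range_succ]
    exact (ih fun i hi => h i (by omega)).add (h _ le_rfl)

theorem leading_invSqrtSeries : Leading 1 invSqrtSeries := ⟨1, by simp, by simp⟩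

theorem catalanSeries_eq_aeval : catalanSeries =
    Polynomial.aeval sqrtSeries (Polynomial.C (1 / 2) * (1 - Polynomial.X) : Polynomial ℝ) := by
  have : (algebraMap ℝ ℝ⟦X⟧) (1 / 2) * 2 = 1 := by
    rw [← map_ofNat (algebraMap ℝ ℝ⟦X⟧) 2, ← map_mul]
    norm_num
  rw [map_mul, Polynomial.aeval_C, map_sub, map_one, Polynomial.aeval_X, sqrtSeries]
  linear_combination (-catalanSeries) * this

theorem leading_catalanSeries : Leading 0 catalanSeries :=
  ⟨Polynomial.C (1 / 2) * (1 - Polynomial.X), by simp [Polynomial.mul_coeff_zero],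
    by rw [pow_zero, one_mul]; exact catalanSeries_eq_aeval⟩

/-- For `k ≥ 2` the convolution has order one more than the preceding series and dominates it. For
`k = 1` it is empty, and for `k = 0` the truncated subtraction gives the correct order 0. -/
theorem leading_markedSeries (k : ℕ) : Leading (2 * k - 1) (markedSeries k) := by
  induction k using Nat.strong_induction_on with
  | _ k ih =>
    rcases k with _ | _ | k
    · rw [markedSeries_zero]
      exact leading_catalanSeries
    · rw [markedSeries_succ, markedSeries_zero]
      simpa using leading_invSqrtSeries.mul leading_catalanSeries
    · rw [markedSeries_succ]
      have h1 : Leading (2 * k + 1) (markedSeries (k + 1)) := ih (k + 1) (by omega)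
      have h2 : Leading (2 * k + 1 + 1) (∑ i ∈ Finset.range (k + 1),
          markedSeries (i + 1) * markedSeries (k + 1 - i)) := by
        refine Leading.sum_range fun i hi => ?_
        have := (ih (i + 1) (by omega)).mul (ih (k + 1 - i) (by omega))
        rwa [show 2 * (i + 1) - 1 + (2 * (k + 1 - i) - 1) = 2 * k + 1 + 1 by omega] at this
      have := leading_invSqrtSeries.mul (h1.lower_add h2)
      rwa [show 1 + (2 * k + 1 + 1) = 2 * (k + 1 + 1) - 1 by omega] at this

/-- Twice the order of the singularity of `rootSeries`: the number of vertices plus the number of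
leaves minus two. -/
def weight : PlaneTree → ℕ
  | node ss => (ss.attach.map fun s => weight s.1).sum + (2 * ss.length - 1)
termination_by T => sizeOf T
decreasing_by
  have := List.sizeOf_lt_of_mem s.2
  simp only [node.sizeOf_spec]
  omega

theorem weight_node (ss : List PlaneTree) :
    weight (node ss) = (ss.map weight).sum + (2 * ss.length - 1) := by
  rw [weight, List.attach_map_val]

theorem leading_rootSeries : ∀ S : PlaneTree, Leading (weight S) (rootSeries S)
  | node ss => by
    have ih : ∀ s ∈ ss, Leading (weight s) (rootSeries s) := fun s hs => leading_rootSeries s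
    have hprod : Leading (ss.map weight).sum (ss.map rootSeries).prod := by
      induction ss with
      | nil => simpa using leading_one
      | cons s ss ih' =>
        simp only [List.map_cons, List.sum_cons, List.prod_cons]
        exact (ih s (by simp)).mul (ih' fun t ht => ih t (by simp [ht]))
    have : rootSeries (node ss) = forestSeries ss := rfl
    rw [this, forestSeries_eq_markedSeries _ ss rfl, weight_node,
      mul_comm (markedSeries _)]
    exact hprod.mul (leading_markedSeries _)
termination_by S => sizeOf S
decreasing_by
  have := List.sizeOf_lt_of_mem hs
  simp only [node.sizeOf_spec]
  omega

/-- The image of the root of `S` is a marked vertex or the root itself, giving the factor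
$C/w+1=(1+w)/(2w)$. -/
theorem treeSeries_eq_rootSeries (S : PlaneTree) : treeSeries [S] = invSqrtSeries *
    Polynomial.aeval sqrtSeries (Polynomial.C (1 / 2) * (1 + Polynomial.X) : Polynomial ℝ) *
      rootSeries S := by
  have h2 : (algebraMap ℝ ℝ⟦X⟧) (1 / 2) * 2 = 1 := by
    rw [← map_ofNat (algebraMap ℝ ℝ⟦X⟧) 2, ← map_mul]
    norm_num
  rw [treeSeries_singleton, forestSeries_eq_markedSeries 1 [S] rfl, markedSeries_succ,
    markedSeries_zero]
  simp only [Finset.range_zero, Finset.sum_empty, add_zero, List.map_cons, List.map_nil,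
    List.prod_cons, List.prod_nil, mul_one, map_mul, Polynomial.aeval_C, map_add, map_one,
    Polynomial.aeval_X]
  have h := sqrtSeries_mul_invSqrtSeries
  rw [sqrtSeries] at h ⊢
  linear_combination (-rootSeries S) * h + (-rootSeries S * invSqrtSeries * (1 - catalanSeries)) * h2

theorem exists_polynomial (S : PlaneTree) : ∃ p : Polynomial ℝ, 0 < p.coeff 0 ∧
    rootSeries S = invSqrtSeries ^ weight S * Polynomial.aeval sqrtSeries p ∧
    treeSeries [S] = invSqrtSeries ^ (weight S + 1) * Polynomial.aeval sqrtSeries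
      (Polynomial.C (1 / 2) * (1 + Polynomial.X) * p : Polynomial ℝ) := by
  obtain ⟨p, hp, h⟩ := leading_rootSeries S
  refine ⟨p, hp, h, ?_⟩
  rw [treeSeries_eq_rootSeries, h, map_mul _ _ p]
  ring

/-! ### Coefficients of powers of $1-4x$ -/

open Filter Topology

/-- The coefficients of `(1 - 4 X) ^ (-s)`. -/
noncomputable def powCoeff (s : ℝ) : ℕ → ℝ
  | 0 => 1
  | n + 1 => powCoeff s n * (4 * (n + s) / (n + 1))

theorem powCoeff_pos {s : ℝ} (hs : 0 < s) (n : ℕ) : 0 < powCoeff s n := by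
  induction n with
  | zero => exact one_pos
  | succ n ih =>
    rw [powCoeff]
    positivity

theorem powCoeff_add_one (s : ℝ) (n : ℕ) : s * powCoeff (s + 1) n = (n + s) * powCoeff s n := by
  induction n with
  | zero => simp [powCoeff]
  | succ n ih =>
    rw [powCoeff, powCoeff]
    push_cast
    linear_combination (4 * (n + (s + 1)) / (n + 1)) * ih

/-- The differential equation is a first-order recurrence for the coefficients, the one that defines
`powCoeff`. -/
theorem coeff_eq_powCoeff {F : ℝ⟦X⟧} {s : ℝ} (h0 : constantCoeff F = 1)
    (h : (1 - 4 * X) * derivative ℝ F = C (4 * s) * F) (n : ℕ) : coeff n F = powCoeff s n := by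
  induction n with
  | zero => simpa [powCoeff] using h0
  | succ n ih =>
    have h1 := congrArg (coeff n) h
    have h2 : (1 - 4 * X) * derivative ℝ F = derivative ℝ F - C 4 * (X * derivative ℝ F) := by
      rw [show (C 4 : ℝ⟦X⟧) = 4 from map_ofNat _ 4]
      ring
    have h3 : coeff n (X * derivative ℝ F) = n * coeff n F := by
      cases n with
      | zero => simp
      | succ n =>
        rw [coeff_succ_X_mul, coeff_derivative]
        push_cast
        ring
    rw [h2, map_sub, coeff_C_mul, coeff_C_mul, h3, coeff_derivative, ih] at h1
    rw [powCoeff]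
    have : (n : ℝ) + 1 ≠ 0 := by positivity
    field_simp
    linear_combination h1

theorem derivative_sqrtSeries : (1 - 4 * X) * derivative ℝ sqrtSeries = -2 * sqrtSeries := by
  have h := congrArg (derivative ℝ) sqrtSeries_mul_self
  have h4 : derivative ℝ (1 - 4 * X : ℝ⟦X⟧) = -4 := by
    rw [show (4 : ℝ⟦X⟧) = C 4 from (map_ofNat _ 4).symm]
    ext n
    cases n <;> simp [coeff_one, ← smul_eq_C_mul]
  rw [h4, Derivation.leibniz, smul_eq_mul] at h
  have h2 : (C (1 / 2) : ℝ⟦X⟧) * 2 = 1 := by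
    rw [← map_ofNat C 2, ← map_mul]
    norm_num
  linear_combination C (1 / 2) * sqrtSeries * h - derivative ℝ sqrtSeries * sqrtSeries_mul_self
    - (sqrtSeries ^ 2 * derivative ℝ sqrtSeries + 2 * sqrtSeries) * h2

theorem derivative_invSqrtSeries :
    (1 - 4 * X) * derivative ℝ invSqrtSeries = 2 * invSqrtSeries := by
  have h := congrArg (derivative ℝ) sqrtSeries_mul_invSqrtSeries
  rw [Derivation.leibniz, smul_eq_mul, smul_eq_mul, Derivation.map_one_eq_zero] at h
  linear_combination sqrtSeries * h
    - (derivative ℝ invSqrtSeries + invSqrtSeries ^ 2 * derivative ℝ sqrtSeries) *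
      sqrtSeries_mul_self
    + (derivative ℝ sqrtSeries * sqrtSeries * invSqrtSeries + 2 * invSqrtSeries) *
      sqrtSeries_mul_invSqrtSeries
    - invSqrtSeries ^ 2 * derivative_sqrtSeries

theorem coeff_pow_mul_pow (i j n : ℕ) : coeff n (invSqrtSeries ^ j * sqrtSeries ^ i) =
    powCoeff (((j : ℝ) - i) / 2) n := by
  refine coeff_eq_powCoeff ?_ ?_ n
  · simp [constantCoeff_invSqrtSeries, constantCoeff_sqrtSeries]
  · have hpow : ∀ (F : ℝ⟦X⟧) (c : ℝ⟦X⟧), (1 - 4 * X) * derivative ℝ F = c * F → ∀ k : ℕ,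
        (1 - 4 * X) * derivative ℝ (F ^ k) = (k : ℝ⟦X⟧) * c * F ^ k := by
      intro F c h k
      induction k with
      | zero => simp
      | succ k ih =>
        rw [pow_succ, Derivation.leibniz, smul_eq_mul, smul_eq_mul]
        push_cast
        linear_combination F ^ k * h + F * ih
    have h1 := hpow _ _ derivative_invSqrtSeries j
    have h2 := hpow _ _ derivative_sqrtSeries i
    have h3 : (C (4 * (((j : ℝ) - i) / 2)) : ℝ⟦X⟧) = 2 * (j : ℝ⟦X⟧) - 2 * (i : ℝ⟦X⟧) := by
      rw [show 4 * (((j : ℝ) - i) / 2) = 2 * j - 2 * i by ring, map_sub, map_mul, map_mul,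
        map_natCast, map_natCast, map_ofNat]
    rw [h3, Derivation.leibniz, smul_eq_mul, smul_eq_mul]
    linear_combination sqrtSeries ^ i * h1 + invSqrtSeries ^ j * h2

/-- With $x_n$ the quotient, $x_n^2(n+t)$ is nonincreasing once $n+s\ge0$, because
$(y-\frac12)^2(y+1)\le y^3$ for $y=n+t\ge\frac12$. Hence $x_n^2=O(1/n)$. -/
theorem tendsto_powCoeff_div {s t : ℝ} (hst : s + 1 / 2 ≤ t) (ht : 0 < t) :
    Tendsto (fun n => powCoeff s n / powCoeff t n) atTop (𝓝 0) := by
  set x : ℕ → ℝ := fun n => powCoeff s n / powCoeff t n with hx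
  have hxs : ∀ n, x (n + 1) = x n * ((n + s) / (n + t)) := by
    intro n
    have h1 := (powCoeff_pos ht n).ne'
    have h2 : (n : ℝ) + t ≠ 0 := by positivity
    simp only [hx, powCoeff]
    field_simp
  obtain ⟨N, hN⟩ := exists_nat_ge (-s)
  have hstep : ∀ n ≥ N, x (n + 1) ^ 2 * ((n + 1 : ℕ) + t) ≤ x n ^ 2 * (n + t) := by
    intro n hn
    have hn' : (N : ℝ) ≤ n := Nat.cast_le.2 hn
    have hτ : (0 : ℝ) < n + t := by positivity
    have h0 : (0 : ℝ) ≤ n + s := by linarith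
    have h1 : ((n : ℝ) + s) ^ 2 ≤ (n + t - 1 / 2) ^ 2 := pow_le_pow_left₀ h0 (by linarith) 2
    have h2 : ((n : ℝ) + t - 1 / 2) ^ 2 * (n + t + 1) ≤ (n + t) ^ 3 := by
      have : (1 : ℝ) / 2 ≤ n + t := by linarith
      nlinarith
    have h3 : ((n : ℝ) + s) ^ 2 * (n + t + 1) ≤ (n + t) ^ 3 :=
      (mul_le_mul_of_nonneg_right h1 (by linarith)).trans h2
    have h4 : (((n : ℝ) + s) / (n + t)) ^ 2 * (n + t + 1) ≤ n + t := by
      rw [div_pow, div_mul_eq_mul_div, div_le_iff₀ (by positivity)]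
      linarith
    rw [hxs, mul_pow]
    push_cast
    calc x n ^ 2 * ((n + s) / (n + t)) ^ 2 * (n + 1 + t)
        = x n ^ 2 * (((n + s) / (n + t)) ^ 2 * (n + t + 1)) := by ring
      _ ≤ x n ^ 2 * (n + t) := mul_le_mul_of_nonneg_left h4 (sq_nonneg _)
  have hbound : ∀ n ≥ N, x n ^ 2 * (n + t) ≤ x N ^ 2 * (N + t) := by
    intro n hn
    induction n, hn using Nat.le_induction with
    | base => exact le_rfl
    | succ n hn ih => exact (hstep n hn).trans ih
  have hsq : Tendsto (fun n => x n ^ 2) atTop (𝓝 0) := by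
    have h1 : Tendsto (fun n : ℕ => x N ^ 2 * (N + t) / (n + t)) atTop (𝓝 0) :=
      tendsto_const_nhds.div_atTop (tendsto_atTop_add_const_right _ _ tendsto_natCast_atTop_atTop)
    refine squeeze_zero' (Eventually.of_forall fun n => sq_nonneg _) ?_ h1
    filter_upwards [eventually_ge_atTop N] with n hn
    rw [le_div_iff₀ (by positivity)]
    exact hbound n hn
  rw [tendsto_zero_iff_abs_tendsto_zero]
  have := hsq.sqrt
  simpa [Real.sqrt_sq_eq_abs, Function.comp_def] using this

theorem coeff_pow_mul_aeval (p : Polynomial ℝ) (j n : ℕ) :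
    coeff n (invSqrtSeries ^ j * Polynomial.aeval sqrtSeries p) =
      ∑ i ∈ Finset.range (p.natDegree + 1), p.coeff i * powCoeff (((j : ℝ) - i) / 2) n := by
  rw [Polynomial.aeval_eq_sum_range, Finset.mul_sum, map_sum]
  refine Finset.sum_congr rfl fun i _ => ?_
  rw [mul_smul_comm, coeff_smul, coeff_pow_mul_pow, smul_eq_mul]

theorem tendsto_coeff_div (p : Polynomial ℝ) {j : ℕ} (hj : 0 < j) :
    Tendsto (fun n => coeff n (invSqrtSeries ^ j * Polynomial.aeval sqrtSeries p) /
      powCoeff ((j : ℝ) / 2) n) atTop (𝓝 (p.coeff 0)) := by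
  have hj' : (0 : ℝ) < j / 2 := by positivity
  simp_rw [coeff_pow_mul_aeval, Finset.sum_div, mul_div_assoc]
  have h : ∀ i ∈ Finset.range (p.natDegree + 1), Tendsto (fun n => p.coeff i *
      (powCoeff (((j : ℝ) - i) / 2) n / powCoeff ((j : ℝ) / 2) n)) atTop
      (𝓝 (p.coeff i * if i = 0 then 1 else 0)) := by
    intro i _
    refine Tendsto.const_mul _ ?_
    split_ifs with hi
    · subst hi
      refine tendsto_const_nhds.congr fun n => ?_
      rw [Nat.cast_zero, sub_zero, div_self (powCoeff_pos hj' n).ne']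
    · refine tendsto_powCoeff_div ?_ hj'
      have : (1 : ℝ) ≤ i := by exact_mod_cast Nat.one_le_iff_ne_zero.2 hi
      linarith
  have := tendsto_finsetSum _ h
  simpa using this

/-- The quotient for $u$ is multiplied by $(n+u)/(n+u+\frac12)$ at each step, which increases with
$u$. The constant makes the case $n=1$ an equality, and it is less than 1. -/
theorem powCoeff_div_le {s t : ℝ} (hs : 0 < s) (hst : s < t) {n : ℕ} (hn : 1 ≤ n) :
    powCoeff s n / powCoeff (s + 1 / 2) n ≤
      s * (t + 1 / 2) / (t * (s + 1 / 2)) * (powCoeff t n / powCoeff (t + 1 / 2) n) := by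
  have ht := hs.trans hst
  have hq : ∀ u : ℝ, 0 < u → ∀ n : ℕ, powCoeff u (n + 1) / powCoeff (u + 1 / 2) (n + 1) =
      powCoeff u n / powCoeff (u + 1 / 2) n * ((n + u) / (n + u + 1 / 2)) := by
    intro u hu n
    have h1 := (powCoeff_pos (by positivity : 0 < u + 1 / 2) n).ne'
    have h2 : (n : ℝ) + u + 1 / 2 ≠ 0 := by positivity
    have h3 : (n : ℝ) + (u + 1 / 2) ≠ 0 := by positivity
    rw [powCoeff, powCoeff, ← add_assoc]
    field_simp
  induction n, hn using Nat.le_induction with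
  | base =>
    rw [hq s hs 0, hq t ht 0]
    simp only [powCoeff, Nat.cast_zero, zero_add]
    apply le_of_eq
    field_simp
  | succ n hn ih =>
    rw [hq s hs n, hq t ht n, ← mul_assoc]
    have hpos := (powCoeff_pos ht n)
    have hpos' := (powCoeff_pos (by positivity : 0 < t + 1 / 2) n)
    refine mul_le_mul ih ?_ (by positivity) (by positivity)
    rw [div_le_div_iff₀ (by positivity) (by positivity)]
    nlinarith

/-! ### Strict growth of the weight under containment -/

/-- The total weight of a forest, normalised so that it is additive under containment. -/
def forestWeight (L : List PlaneTree) : ℕ := (L.map fun s => weight s + 2).sum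

theorem forestWeight_cons (s : PlaneTree) (L : List PlaneTree) :
    forestWeight (s :: L) = weight s + 2 + forestWeight L := by
  simp [forestWeight]

theorem forestWeight_append (L M : List PlaneTree) :
    forestWeight (L ++ M) = forestWeight L + forestWeight M := by
  simp [forestWeight]

theorem forestWeight_eq (L : List PlaneTree) :
    forestWeight L = (L.map weight).sum + 2 * L.length := by
  simp [forestWeight, List.sum_map_add, mul_comm]

theorem weight_node_nil : weight (node []) = 0 := by simp [weight_node]

theorem weight_node_cons (s : PlaneTree) (L : List PlaneTree) :
    weight (node (s :: L)) + 1 = forestWeight (s :: L) := by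
  rw [weight_node, forestWeight_eq, List.length_cons]
  omega

theorem forestWeight_lt (M : List PlaneTree) : forestWeight M < weight (node M) + 2 := by
  cases M with
  | nil => simp [forestWeight]
  | cons s M =>
    have := weight_node_cons s M
    omega

/-- The weight of `node M` is `forestWeight M - 1`, except that both vanish for empty `M`. Nonempty
forests have `forestWeight` at least 2, so the exception does not disturb the comparison. -/
theorem weight_node_le {ss M : List PlaneTree} (h : forestWeight ss ≤ forestWeight M ∧
    (forestWeight ss = forestWeight M → ss = M)) :
    weight (node ss) ≤ weight (node M) ∧ (weight (node ss) = weight (node M) → ss = M) := by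
  rcases ss with _ | ⟨s, ss⟩ <;> rcases M with _ | ⟨t, M⟩
  · simp
  · have h1 := weight_node_cons t M
    have h2 := forestWeight_cons t M
    rw [weight_node_nil]
    omega
  · have h2 := forestWeight_cons s ss
    have h3 : forestWeight [] = 0 := rfl
    omega
  · have h1 := weight_node_cons t M
    have h2 := weight_node_cons s ss
    exact ⟨by omega, fun h3 => h.2 (by omega)⟩

theorem forestWeight_le_of_treeCount {L M : List PlaneTree}
    (ih : ∀ L, forestCount L M ≠ 0 →
      forestWeight L ≤ forestWeight M ∧ (forestWeight L = forestWeight M → L = M))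
    (h : treeCount L (node M) ≠ 0) :
    forestWeight L ≤ weight (node M) + 2 ∧
      (forestWeight L = weight (node M) + 2 → L = [node M]) := by
  have hlt := forestWeight_lt M
  have avoid : forestCount L M ≠ 0 → forestWeight L ≤ weight (node M) + 2 ∧
      (forestWeight L = weight (node M) + 2 → L = [node M]) := fun h' => by
    have := (ih L h').1
    omega
  by_cases hL : L.length = 1
  · obtain ⟨⟨ss⟩, rfl⟩ := List.length_eq_one_iff.1 hL
    rw [treeCount_singleton] at h
    by_cases h' : forestCount [node ss] M = 0
    · have h1 := weight_node_le (ih ss (by omega))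
      have h2 : forestWeight [node ss] = weight (node ss) + 2 := by simp [forestWeight]
      refine ⟨by omega, fun h3 => ?_⟩
      rw [h1.2 (by omega)]
    · exact avoid h'
  · rw [treeCount_of_length_ne_one hL] at h
    exact avoid h

/-- Cutting at the leftmost branch bounds both pieces, and equality of the sums forces equality in
each piece. -/
theorem forestWeight_le : ∀ (M L : List PlaneTree), forestCount L M ≠ 0 →
    forestWeight L ≤ forestWeight M ∧ (forestWeight L = forestWeight M → L = M)
  | [], L, h => by
    rw [forestCount_nil_right] at h
    obtain rfl : L = [] := by
      by_contra hL
      exact h (if_neg hL)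
    simp
  | node N :: M, L, h => by
    rw [forestCount_cons] at h
    obtain ⟨k, -, hk⟩ := Finset.exists_ne_zero_of_sum_ne_zero h
    have h1 := forestWeight_le_of_treeCount (forestWeight_le N) (left_ne_zero_of_mul hk)
    have h2 := forestWeight_le M _ (right_ne_zero_of_mul hk)
    have h3 := forestWeight_append (L.take k) (L.drop k)
    rw [List.take_append_drop] at h3
    rw [forestWeight_cons]
    refine ⟨by omega, fun h4 => ?_⟩
    rw [← List.take_append_drop k L, h1.2 (by omega), h2.2 (by omega)]
    rfl
termination_by M => sizeOf M

theorem EmbedsInto.weight_lt {S T : PlaneTree} (h : EmbedsInto S T) (hne : S ≠ T) :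
    weight S < weight T := by
  obtain ⟨X, hX⟩ := h
  obtain ⟨M⟩ := T
  have h0 : treeCount [S] (node M) ≠ 0 := by
    exact Set.ncard_ne_zero_of_mem (isEmbedding_iff.1 hX) (finite_copies (finite_vertices _) _)
  have h1 := forestWeight_le_of_treeCount (forestWeight_le M) h0
  have h2 : forestWeight [S] = weight S + 2 := by simp [forestWeight]
  have h3 : weight S ≠ weight (node M) := fun h => hne (by simpa using h1.2 (by omega))
  omega

theorem eq_of_weight_eq_zero {S : PlaneTree} (h : weight S = 0) : S = node [] := by
  rcases S with ⟨_ | ⟨s, L⟩⟩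
  · rfl
  · have := weight_node_cons s L
    have := forestWeight_cons s L
    omega

/-! ### Asymptotics and comparison of the ratios -/

theorem tendsto_allTotal_div (S : PlaneTree) : ∃ c : ℝ, 0 < c ∧
    Tendsto (fun n => (allTotal n S : ℝ) / powCoeff ((weight S : ℝ) / 2 + 1 / 2) n) atTop (𝓝 c) ∧
    (0 < weight S → Tendsto (fun n => (goodTotal n S : ℝ) / powCoeff ((weight S : ℝ) / 2) n) atTop
      (𝓝 (2 * c))) := by
  obtain ⟨p, hp, hg, ha⟩ := exists_polynomial S
  -- The polynomial for all embeddings is $\frac12(1+w)p$, with half the constant term of $p$.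
  refine ⟨1 / 2 * p.coeff 0, by positivity, ?_, fun h => ?_⟩
  · have := tendsto_coeff_div (Polynomial.C (1 / 2) * (1 + Polynomial.X) * p)
      (Nat.succ_pos (weight S))
    rw [Nat.succ_eq_add_one, ← ha] at this
    simp only [coeff_treeSeries, Polynomial.mul_coeff_zero, Polynomial.coeff_C_zero,
      Polynomial.coeff_add, Polynomial.coeff_one_zero, Polynomial.coeff_X_zero, add_zero,
      mul_one] at this
    rwa [show ((weight S : ℝ) / 2 + 1 / 2) = ((weight S + 1 : ℕ) : ℝ) / 2 by push_cast; ring]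
  · have := tendsto_coeff_div p h
    rw [← hg] at this
    simp only [coeff_rootSeries] at this
    rwa [show 2 * (1 / 2 * p.coeff 0) = p.coeff 0 by ring]

theorem eventually_allTotal_pos (S : PlaneTree) : ∀ᶠ n in atTop, 0 < allTotal n S := by
  obtain ⟨c, hc, h, -⟩ := tendsto_allTotal_div S
  filter_upwards [h.eventually_const_lt hc] with n hn
  rcases Nat.eq_zero_or_pos (allTotal n S) with h0 | h0
  · simp [h0] at hn
  · exact h0

/-- The coefficientwise quotient of `(1 - 4 X) ^ (-s)` and `(1 - 4 X) ^ (-s - 1 / 2)`. -/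
noncomputable def powRatio (s : ℝ) (n : ℕ) : ℝ := powCoeff s n / powCoeff (s + 1 / 2) n

theorem powRatio_pos {s : ℝ} (hs : 0 < s) (n : ℕ) : 0 < powRatio s n :=
  div_pos (powCoeff_pos hs n) (powCoeff_pos (by positivity) n)

theorem tendsto_ratio {S : PlaneTree} (hS : 0 < weight S) :
    Tendsto (fun n => (goodTotal n S : ℝ) / allTotal n S / powRatio ((weight S : ℝ) / 2) n) atTop
      (𝓝 2) := by
  obtain ⟨c, hc, h1, h2⟩ := tendsto_allTotal_div S
  have := (h2 hS).div h1 hc.ne'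
  rw [mul_div_cancel_right₀ _ hc.ne'] at this
  refine this.congr fun n => ?_
  rw [Pi.div_apply, powRatio]
  field_simp

theorem goodTotal_leaf {n : ℕ} (hn : 0 < n) :
    (goodTotal n (node []) : ℝ) = -(1 / 2) * powCoeff (-(1 / 2)) n := by
  have h := catalanSeries_eq_aeval
  have h1 : rootSeries (node []) = catalanSeries := rfl
  rw [← coeff_rootSeries, h1, h, map_mul, Polynomial.aeval_C, map_sub, map_one, Polynomial.aeval_X,
    ← Algebra.smul_def, coeff_smul, map_sub, coeff_one, if_neg hn.ne', smul_eq_mul]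
  have h2 := coeff_pow_mul_pow 1 0 n
  rw [pow_zero, pow_one, one_mul] at h2
  rw [h2]
  norm_num

/-- Here the good embeddings come from the term $-w/2$ of $C$, so they are smaller by a further
factor $w$ than a tree of weight 1 would suggest. -/
theorem tendsto_ratio_leaf :
    Tendsto (fun n => (goodTotal n (node []) : ℝ) / allTotal n (node []) / powRatio (1 / 2) n)
      atTop (𝓝 0) := by
  obtain ⟨c, hc, h1, -⟩ := tendsto_allTotal_div (node [])
  rw [weight_node_nil, Nat.cast_zero, zero_div, zero_add] at h1
  have h2 := tendsto_powCoeff_div (s := 1) (t := 1 + 1 / 2) le_rfl (by norm_num)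
  -- This is $\frac{2n+1}{2(2n-1)}$, the factor produced by `powCoeff_add_one` at $-\frac12$ and at
  -- $\frac12$.
  have h3 : Tendsto (fun n : ℕ => 1 / 2 + 1 / (2 * (n : ℝ) - 1)) atTop (𝓝 (1 / 2 + 0)) := by
    refine tendsto_const_nhds.add (tendsto_const_nhds.div_atTop ?_)
    exact tendsto_atTop_add_const_right _ _
      (tendsto_natCast_atTop_atTop.const_mul_atTop two_pos)
  have h4 := (h3.mul h2).div h1 hc.ne'
  rw [mul_zero, zero_div] at h4
  refine h4.congr' ?_
  filter_upwards [eventually_ge_atTop 1] with n hn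
  have hn' : (1 : ℝ) ≤ n := by exact_mod_cast hn
  have e1 := powCoeff_add_one (-(1 / 2)) n
  have e2 := powCoeff_add_one (1 / 2) n
  rw [show -(1 / 2) + 1 = (1 / 2 : ℝ) by norm_num] at e1
  rw [show (1 : ℝ) + 1 / 2 = 1 / 2 + 1 by norm_num] at *
  have p1 := powCoeff_pos (s := 1 / 2) (by norm_num) n
  have p2 := powCoeff_pos (s := 1) (by norm_num) n
  have p3 := powCoeff_pos (s := 1 / 2 + 1) (by norm_num) n
  have hne : 2 * (n : ℝ) - 1 ≠ 0 := by linarith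
  have e1' : powCoeff (-(1 / 2)) n = -(powCoeff (1 / 2) n) / (2 * n - 1) := by
    rw [eq_div_iff hne]
    linear_combination (-2) * e1
  have e2' : powCoeff (1 / 2 + 1) n = (2 * n + 1) * powCoeff (1 / 2) n := by
    linear_combination 2 * e2
  rw [Pi.div_apply, goodTotal_leaf hn, powRatio, e1', e2', add_halves]
  have hne' : 2 * (n : ℝ) + 1 ≠ 0 := by positivity
  field_simp
  ring

/-- The strict gap `c < 2` absorbs the error terms, since the larger tree has limit 2 on the same
scale. -/
theorem eventually_ratio_le {S : PlaneTree} {k : ℕ} (hk : weight S < k) :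
    ∃ c < (2 : ℝ), ∀ᶠ n in atTop,
      (goodTotal n S : ℝ) / allTotal n S ≤ c * powRatio ((k : ℝ) / 2) n := by
  rcases Nat.eq_zero_or_pos (weight S) with h0 | h0
  · obtain rfl := eq_of_weight_eq_zero h0
    refine ⟨1, one_lt_two, ?_⟩
    filter_upwards [tendsto_ratio_leaf.eventually_le_const one_pos, eventually_ge_atTop 1]
      with n hn hn1
    rw [div_le_iff₀ (powRatio_pos (by norm_num) n)] at hn
    refine hn.trans (mul_le_mul_of_nonneg_left ?_ zero_le_one)
    rcases eq_or_lt_of_le (show 1 ≤ k by omega) with rfl | hk1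
    · simp
    · have hk2 : (1 : ℝ) < k := by exact_mod_cast hk1
      refine (powCoeff_div_le (by norm_num) (by linarith : (1 / 2 : ℝ) < k / 2) hn1).trans ?_
      refine mul_le_of_le_one_left (powRatio_pos (by positivity) n).le ?_
      rw [div_le_one (by positivity)]
      nlinarith
  · have hs : (0 : ℝ) < weight S / 2 := by positivity
    have hst : (weight S : ℝ) / 2 < k / 2 := by
      have : (weight S : ℝ) < k := by exact_mod_cast hk
      linarith
    set s := (weight S : ℝ) / 2
    set t := (k : ℝ) / 2
    have ht := hs.trans hst
    set δ := s * (t + 1 / 2) / (t * (s + 1 / 2)) with hδ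
    have hδ0 : 0 < δ := by positivity
    have hδ1 : δ < 1 := by
      rw [hδ, div_lt_one (by positivity)]
      nlinarith
    -- The bound $1+1/\delta$ exceeds the limit 2, yet passing from $s$ to $t$ multiplies it by
    -- $\delta$ and leaves $1+\delta<2$.
    have h2 : 2 < 1 + 1 / δ := by
      have := one_lt_one_div hδ0 hδ1
      linarith
    refine ⟨1 + δ, by linarith, ?_⟩
    filter_upwards [(tendsto_ratio h0).eventually_le_const h2, eventually_ge_atTop 1] with n hn hn1
    rw [div_le_iff₀ (powRatio_pos hs n)] at hn
    calc (goodTotal n S : ℝ) / allTotal n S ≤ (1 + 1 / δ) * powRatio s n := hn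
      _ ≤ (1 + 1 / δ) * (δ * powRatio t n) :=
        mul_le_mul_of_nonneg_left (powCoeff_div_le hs hst hn1) (by positivity)
      _ = (1 + δ) * powRatio t n := by
        field_simp
        ring

end PlaneTree

theorem mainTheorem12 (S₁ S₂ : PlaneTree) (h : PlaneTree.EmbedsInto S₁ S₂) :
    ∀ᶠ n : ℕ in Filter.atTop,
      0 < PlaneTree.allTotal n S₁ ∧ 0 < PlaneTree.allTotal n S₂ ∧
        (PlaneTree.goodTotal n S₁ : ℝ) / (PlaneTree.allTotal n S₁ : ℝ) ≤
          (PlaneTree.goodTotal n S₂ : ℝ) / (PlaneTree.allTotal n S₂ : ℝ) := by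
  by_cases hne : S₁ = S₂
  · subst hne
    filter_upwards [PlaneTree.eventually_allTotal_pos S₁] with n hn
    exact ⟨hn, hn, le_rfl⟩
  · have hlt := h.weight_lt hne
    have hpos : 0 < S₂.weight := by omega
    obtain ⟨c, hc, hle⟩ := PlaneTree.eventually_ratio_le hlt
    filter_upwards [PlaneTree.eventually_allTotal_pos S₁, PlaneTree.eventually_allTotal_pos S₂, hle,
      (PlaneTree.tendsto_ratio hpos).eventually_const_le hc] with n h1 h2 h3 h4
    refine ⟨h1, h2, h3.trans ?_⟩
    rwa [le_div_iff₀ (PlaneTree.powRatio_pos (by positivity) n)] at h4
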